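/- **Self-improvement lemma.** There is a universal constant $C>0$ such that the following holds. *Setting.* Let $F$ be a finite field with $p=|F|\ge 3$ elements and let $n\ge 1$. In the $3$-player multilinearity game in $n$ variables over $F$ the referee performs one of two tests, each with probability $1/2$. Consistency test: he sends the same uniformly random $x\in F^n$ to all players and accepts iff the three answers in $F$ are equal. Linearity test: he picks uniformly $i\in\{1,\dots,n\}$, $x\in F^n$ and $y_i\ne z_i$ in $F\setminus\{x_i\}$, sets $y_j=z_j=x_j$ for $j\ne i$, sends $x,y,z$ to the three players, receives $a,b,c\in F$ and accepts iff $\frac{b-a}{y_i-x_i}=\frac{c-b}{z_i-y_i}=\frac{c-a}{z_i-x_i}$. A symmetric projective strategy consists of a finite-dimensional Hilbert space $\mathcal H=\mathbb C^d$, a permutation-invariant unit vector $|\Psi\rangle\in\mathcal H^{\otimes 3}$ and, for every $x\in F^n$, a projective measurement $\{A_x^a\}_{a\in F}$ on $\mathcal H$, used by all three players. Write $\mathrm{Tr}_\rho(X\otimes Y)=\langle\Psi|X\otimes Y\otimes \mathrm{Id}|\Psi\rangle$ and $\|X\|_\rho^2=\langle\Psi|XX^\dagger\otimes \mathrm{Id}\otimes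 \mathrm{Id}|\Psi\rangle$. For $0\le k\le n$ let $\mathrm{ML}(F^k,F)$ be the set of functions $F^k\to F$ that are of the form $t\mapsto at+b$ in each coordinate separately. A family of sub-measurements of arity $k$ is a collection of positive semidefinite operators $P_{z}^g$ on $\mathcal H$, for $z\in F^{n-k}$ and $g\in \mathrm{ML}(F^k,F)$, with $\sum_g P_z^g\le \mathrm{Id}$ for every $z$. For $x\in F^n$ write $x_{\le k}=(x_1,\dots,x_k)$ and $x_{>k}=(x_{k+1},\dots,x_n)$. For families $P,Q$ of arities $k\le\ell$ let $$\mathrm{cons}(P,Q)=\mathop{\mathrm E}_{x\in F^n}\ \sum_{f,g:\ g|_{x}=f}\mathrm{Tr}_\rho\big(P_{x_{>k}}^f\otimes Q_{x_{>\ell}}^g\big),\qquad \mathrm{inc}(P,Q)=\mathop{\mathrm E}_{x\in F^n}\ \sum_{f,g:\ g|_{x}\neq f}\mathrm{Tr}_\rho\big(P_{x_{>k}}^f\otimes Q_{x_{>\ell}}^g\big),$$ where $g|_x\in\mathrm{ML}(F^k,F)$ is $g$ with its last $\ell-k$ variables set to $x_{k+1},\dots,x_\ell$; for $k>\ell$ put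 $\mathrm{cons}(P,Q)=\mathrm{cons}(Q,P)$ and $\mathrm{inc}(P,Q)=\mathrm{inc}(Q,P)$. The measurements $A=\{A_x^a\}$ are regarded as a family of arity $0$. *Statement.* Let $\varepsilon>0$ and $\delta$ satisfy $n^{-8}\ge\delta\ge\sqrt n\,\varepsilon^{1/8}\ge 1/p$. Let $(|\Psi\rangle,\{A_x^a\})$ be a symmetric projective strategy that is accepted with probability at least $1-\varepsilon/2$ in the $3$-player multilinearity game, and let $R$ be a family of sub-measurements of arity $k$, $0\le k\le n$, with $\mathrm{inc}(R,A)\le\delta$. Then there are a family of sub-measurements $T$ of arity $k$ and matrices $\hat S_x^g$ on $\mathcal H$, for $x\in F^n$ and $g\in\mathrm{ML}(F^k,F)$, such that: 1. $\mathrm{inc}(T,A)\le C\,\varepsilon^{1/16}$; 2. for every family of sub-measurements $P$, of arbitrary arity, $|\mathrm{cons}(P,R)-\mathrm{cons}(P,T)|\le C\sqrt\delta$; 3. for every $x\in F^n$ and $a\in F$, $\ \sum_{g:\,g(x_{\le k})=a}\hat S_x^g(\hat S_x^g)^\dagger\le A_x^a$; for every $z\in F^{n-k}$ and $g$, $\ T_z^g=\big(\mathrm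 E_{w\in F^k}\hat S_{(w,z)}^g\big)\big(\mathrm E_{w\in F^k}\hat S_{(w,z)}^g\big)^\dagger$; and $$\mathop{\mathrm E}_{x\in F^n}\sum_g\Big\|\hat S_x^g-\sqrt{T_{x_{>k}}^g}\Big\|_\rho^2\le\delta .$$ -/

import Mathlib

open scoped BigOperators Kronecker ComplexOrder MatrixOrder Matrix

noncomputable section

namespace MultilinGame

universe u v

/-- Multilinear functions `F^k → F` in the sense of multi-affine functions: in each coordinate
separately the function has the form `t ↦ a * t + b`. -/
def ML (F : Type u) [Field F] (k : ℕ) : Type u :=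
  {g : (Fin k → F) → F //
    ∀ (i : Fin k) (w : Fin k → F), ∃ a b : F, ∀ t : F, g (Function.update w i t) = a * t + b}

instance instFintypeML (F : Type u) [Field F] [Fintype F] (k : ℕ) : Fintype (ML F k) := by
  classical
  unfold ML
  exact Fintype.ofFinite _

/-- The tuples of values of the coordinates after the first `k` ones: a copy of `F^(n-k)`. -/
abbrev Tail (F : Type u) (n k : ℕ) : Type u := {i : Fin n // k ≤ (i : ℕ)} → F

/-- The first `k` coordinates of a point of `F^n`. -/
def headPart {F : Type u} {n k : ℕ} (hk : k ≤ n) (x : Fin n → F) : Fin k → F :=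
  fun j => x (Fin.castLE hk j)

/-- The coordinates of a point of `F^n` after the first `k` ones. -/
def tailPart {F : Type u} {n : ℕ} (k : ℕ) (x : Fin n → F) : Tail F n k :=
  fun i => x i.1

/-- The point of `F^n` with first `k` coordinates `w` and remaining coordinates `z`. -/
def glue {F : Type u} {n k : ℕ} (w : Fin k → F) (z : Tail F n k) : Fin n → F :=
  fun i => if h : (i : ℕ) < k then w ⟨i, h⟩ else z ⟨i, not_lt.mp h⟩

section Operators

variable {d : Type v} [Fintype d] [DecidableEq d]

/-- `⟨ψ| X ⊗ Y ⊗ Z |ψ⟩` for a vector `ψ` of `ℂ^d ⊗ ℂ^d ⊗ ℂ^d`. -/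
def expVal (ψ : d × d × d → ℂ) (X Y Z : Matrix d d ℂ) : ℂ :=
  star ψ ⬝ᵥ ((X ⊗ₖ (Y ⊗ₖ Z)) *ᵥ ψ)

/-- `Tr_ρ(X ⊗ Y)`, with `ρ` the reduced density of `ψ` on two registers. It is only used with
positive semidefinite `X` and `Y`, where the expectation value is real. -/
def trRho (ψ : d × d × d → ℂ) (X Y : Matrix d d ℂ) : ℝ :=
  (expVal ψ X Y 1).re

/-- `‖X‖_ρ² = Tr(X X† ρ)`, with `ρ` the reduced density of `ψ` on one register. -/
def rhoNormSq (ψ : d × d × d → ℂ) (X : Matrix d d ℂ) : ℝ :=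
  (expVal ψ (X * Xᴴ) 1 1).re

end Operators

/-- A symmetric projective strategy for the three players in the multilinearity game in `n`
variables over `F`: the local Hilbert space of each player is `ℂ^d`. -/
structure Strategy (F : Type u) [Fintype F] (d : Type v) [Fintype d] [DecidableEq d] (n : ℕ) where
  /-- the shared state -/
  ψ : d × d × d → ℂ
  /-- the operators `A x a`, with question `x` and answer `a` -/
  A : (Fin n → F) → F → Matrix d d ℂ
  norm_eq_one : star ψ ⬝ᵥ ψ = 1
  perm_invariant : ∀ (σ : Equiv.Perm (Fin 3)) (s : Fin 3 → d),
    ψ (s (σ 0), s (σ 1), s (σ 2)) = ψ (s 0, s 1, s 2)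
  posSemidef : ∀ x a, (A x a).PosSemidef
  projector : ∀ x a, A x a * A x a = A x a
  sum_eq_one : ∀ x, ∑ a, A x a = 1

/-- A family of sub-measurements of arity `k`, with `0 ≤ k ≤ n`: for each value of the coordinates
after the first `k` ones, a sub-measurement with outcomes the multilinear functions of
`k` variables. -/
structure SubFamily (F : Type u) [Field F] [Fintype F] (d : Type v) [Fintype d] [DecidableEq d]
    (n k : ℕ) where
  op : Tail F n k → ML F k → Matrix d d ℂ
  arity_le : k ≤ n
  posSemidef : ∀ z g, (op z g).PosSemidef
  sum_le_one : ∀ z, ∑ g, op z g ≤ 1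

section Game

variable {F : Type u} [Field F] [Fintype F] {d : Type v} [Fintype d] [DecidableEq d] {n : ℕ}

/-- Success probability in the consistency test. -/
def Strategy.consProb (S : Strategy F d n) : ℝ :=
  𝔼 x : Fin n → F, ∑ a : F, (expVal S.ψ (S.A x a) (S.A x a) (S.A x a)).re

/-- Acceptance in the linearity test, when the `i`-th coordinates of the three questions are
`s`, `t`, `r` and the answers are `a`, `b`, `c`. -/
def linAccept (s t r a b c : F) : Prop :=
  (b - a) / (t - s) = (c - b) / (r - t) ∧ (c - b) / (r - t) = (c - a) / (r - s)

open scoped Classical in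
/-- The random choices of the referee in the linearity test: a direction `i`, a point `x` and
values `y_i`, `z_i` such that `x_i`, `y_i`, `z_i` are pairwise distinct. -/
def linChoices (F : Type u) [Fintype F] (n : ℕ) : Finset (Fin n × (Fin n → F) × F × F) :=
  Finset.univ.filter fun q =>
    q.2.2.1 ≠ q.2.1 q.1 ∧ q.2.2.2 ≠ q.2.1 q.1 ∧ q.2.2.1 ≠ q.2.2.2

open scoped Classical in
/-- Success probability in the linearity test. Since the strategy is symmetric, the assignment of
the three questions to the three players is immaterial. -/
def Strategy.linProb (S : Strategy F d n) : ℝ :=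
  𝔼 q ∈ linChoices F n, ∑ a : F, ∑ b : F, ∑ c : F,
    if linAccept (q.2.1 q.1) q.2.2.1 q.2.2.2 a b c then
      (expVal S.ψ (S.A q.2.1 a) (S.A (Function.update q.2.1 q.1 q.2.2.1) b)
        (S.A (Function.update q.2.1 q.1 q.2.2.2) c)).re
    else 0

/-- Success probability in the multilinearity game: either test is run with probability `1/2`. -/
def Strategy.winProb (S : Strategy F d n) : ℝ :=
  (S.consProb + S.linProb) / 2

/-- For `g` a function of the first `ℓ` variables and `k ≤ ℓ`, the function of the first `k`
variables obtained from `g` by setting the remaining ones to the coordinates of `x`. -/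
def restrictAt {k ℓ : ℕ} (hℓ : ℓ ≤ n) (g : (Fin ℓ → F) → F) (x : Fin n → F) : (Fin k → F) → F :=
  fun w => g fun j => if h : (j : ℕ) < k then w ⟨j, h⟩ else x (Fin.castLE hℓ j)

open scoped Classical in
/-- The consistency of two families whose arities satisfy `k ≤ ℓ`. -/
def consLE (ψ : d × d × d → ℂ) {k ℓ : ℕ} (P : SubFamily F d n k) (Q : SubFamily F d n ℓ) : ℝ :=
  𝔼 x : Fin n → F, ∑ f : ML F k, ∑ g : ML F ℓ,
    if restrictAt Q.arity_le g.1 x = f.1 then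
      trRho ψ (P.op (tailPart k x) f) (Q.op (tailPart ℓ x) g) else 0

open scoped Classical in
/-- The inconsistency of two families whose arities satisfy `k ≤ ℓ`. -/
def incLE (ψ : d × d × d → ℂ) {k ℓ : ℕ} (P : SubFamily F d n k) (Q : SubFamily F d n ℓ) : ℝ :=
  𝔼 x : Fin n → F, ∑ f : ML F k, ∑ g : ML F ℓ,
    if restrictAt Q.arity_le g.1 x ≠ f.1 then
      trRho ψ (P.op (tailPart k x) f) (Q.op (tailPart ℓ x) g) else 0

/-- The consistency `cons(P, Q)` of two families of arbitrary arities. -/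
def cons (ψ : d × d × d → ℂ) {k ℓ : ℕ} (P : SubFamily F d n k) (Q : SubFamily F d n ℓ) : ℝ :=
  if k ≤ ℓ then consLE ψ P Q else consLE ψ Q P

/-- The inconsistency `inc(P, Q)` of two families of arbitrary arities. -/
def inc (ψ : d × d × d → ℂ) {k ℓ : ℕ} (P : SubFamily F d n k) (Q : SubFamily F d n ℓ) : ℝ :=
  if k ≤ ℓ then incLE ψ P Q else incLE ψ Q P

/-- A multilinear function of no variables is a constant. -/
def constEquiv (F : Type u) [Field F] : ML F 0 ≃ F where
  toFun f := f.1 Fin.elim0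
  invFun a := ⟨fun _ => a, fun i => i.elim0⟩
  left_inv f := Subtype.ext (funext fun _ => congrArg f.1 (Subsingleton.elim _ _))
  right_inv _ := rfl

/-- The measurements of a strategy, as a family of (sub-)measurements of arity `0`. -/
def Strategy.toFamily (S : Strategy F d n) : SubFamily F d n 0 where
  op z f := S.A (glue Fin.elim0 z) (constEquiv F f)
  arity_le := Nat.zero_le n
  posSemidef _ _ := S.posSemidef _ _
  sum_le_one z := by
    rw [Equiv.sum_comp (constEquiv F) (fun a => S.A (glue Fin.elim0 z) a), S.sum_eq_one]

end Game

end MultilinGame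

end

/-! Let `B = selAvg z g` be the average over `w` of the projections `p_w = A_{(w,z)}^{g(w)}`, and
put `T = B R B`. Everything follows once the `p_w` are shown to be close to `B` in the seminorm
weighted by `R`; the mean square distance is `spread`.

Given this, a partial isometry in the polar decomposition of `B √R` yields `Y` with `Y Y† ≤ R` and
`B Y = √T`. Set `Ŝ_x^g = p_w Y`, where `x = (w, z)`. Its average over `w` is `√T`; the operators
`p_w R p_w` with `g(w) = a` sum to at most `A_x^a`; and the distance of `Ŝ` from `√T` is at most
`spread`. Writing `R - B R B = (1 - B) R + B R (1 - B)` and applying Cauchy-Schwarz compares `R`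
with `T`. Moving `p_w` between registers by the consistency test makes `inc(T, A)` small when
`spread` is small.

For the spread, move `p_w` to the second register, where it commutes with the weight `R`. The
Efron-Stein inequality (`wn_variance_le_dirichlet`) reduces the variance over `w` to variances on
axis-parallel lines. On a line with average `b` of the projections, `b - b² ≤ s (1 - b) + b² (1 - b)
/ s`. The average of `1 - b` is the inconsistency of `R` with `A`, and the small factor `s` is
gained on it. The term `b² (1 - b)` averages `p_t (1 - p_{t'}) p_{t''}`: the answers at `t` and
`t''` agree with `g` but that at `t'` does not, which the linearity test detects because `g` is
affine on the line (`sum_wn_line_le`). The coincidence `t'' = t`, of probability `1/p`, is absorbed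
into the left side when `s ≥ 4/p` (`absorb_le`).

With `m = √n`, `e = ε^{1/8}` and `s = 4 m e` this gives a spread of at most `12 e^8 + 32 m³ e δ + 10
m e³` (`spread_numeric`), which is below `δ` for small `e`. -/

namespace MultilinGame

open Finset

universe u v

/-! ### Operators on the three tensor factors. -/

section Registers

variable {d : Type v} [Fintype d] [DecidableEq d]

/-- An operator acting on the first of three registers. -/
def reg1 : Matrix d d ℂ →⋆ₐ[ℂ] Matrix (d × d × d) (d × d × d) ℂ where
  toFun X := X ⊗ₖ (1 ⊗ₖ 1)
  map_one' := by simp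
  map_mul' X Y := by simp [← Matrix.mul_kronecker_mul]
  map_zero' := by simp
  map_add' X Y := Matrix.add_kronecker _ _ _
  commutes' r := by simp [Algebra.algebraMap_eq_smul_one, Matrix.smul_kronecker]
  map_star' X := by simp [Matrix.star_eq_conjTranspose, Matrix.conjTranspose_kronecker]

/-- An operator acting on the second of three registers. -/
def reg2 : Matrix d d ℂ →⋆ₐ[ℂ] Matrix (d × d × d) (d × d × d) ℂ where
  toFun X := 1 ⊗ₖ (X ⊗ₖ 1)
  map_one' := by simp
  map_mul' X Y := by simp [← Matrix.mul_kronecker_mul]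
  map_zero' := by simp
  map_add' X Y := by simp [Matrix.add_kronecker, Matrix.kronecker_add]
  commutes' r := by
    simp [Algebra.algebraMap_eq_smul_one, Matrix.smul_kronecker, Matrix.kronecker_smul]
  map_star' X := by simp [Matrix.star_eq_conjTranspose, Matrix.conjTranspose_kronecker]

/-- An operator acting on the third of three registers. -/
def reg3 : Matrix d d ℂ →⋆ₐ[ℂ] Matrix (d × d × d) (d × d × d) ℂ where
  toFun X := 1 ⊗ₖ (1 ⊗ₖ X)
  map_one' := by simp
  map_mul' X Y := by simp [← Matrix.mul_kronecker_mul]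
  map_zero' := by simp
  map_add' X Y := by simp [Matrix.kronecker_add]
  commutes' r := by simp [Algebra.algebraMap_eq_smul_one, Matrix.kronecker_smul]
  map_star' X := by simp [Matrix.star_eq_conjTranspose, Matrix.conjTranspose_kronecker]

lemma commute_reg1_reg2 (X Y : Matrix d d ℂ) : Commute (reg1 X) (reg2 Y) := by
  simp [Commute, SemiconjBy, reg1, reg2, ← Matrix.mul_kronecker_mul]

lemma commute_reg1_reg3 (X Y : Matrix d d ℂ) : Commute (reg1 X) (reg3 Y) := by
  simp [Commute, SemiconjBy, reg1, reg3, ← Matrix.mul_kronecker_mul]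

lemma commute_reg2_reg3 (X Y : Matrix d d ℂ) : Commute (reg2 X) (reg3 Y) := by
  simp [Commute, SemiconjBy, reg2, reg3, ← Matrix.mul_kronecker_mul]

end Registers

/-! ### Weighted seminorms defined by a vector state. -/

section VectorState

variable {D : Type v} [Fintype D]

/-- The real part of the expectation value `⟨ψ| X |ψ⟩`. -/
noncomputable def ev (ψ : D → ℂ) : Matrix D D ℂ →ₗ[ℝ] ℝ where
  toFun X := (star ψ ⬝ᵥ (X *ᵥ ψ)).re
  map_add' X Y := by simp [Matrix.add_mulVec, dotProduct_add]
  map_smul' r X := by simp [Matrix.smul_mulVec, dotProduct_smul]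

lemma map_expect_of_additive {ι M N G : Type*} [AddCommGroup M] [AddCommGroup N] [Module ℚ≥0 M]
    [Module ℚ≥0 N] [FunLike G M N] [AddMonoidHomClass G M N] (f : G) (s : Finset ι) (x : ι → M) :
    f (𝔼 i ∈ s, x i) = 𝔼 i ∈ s, f (x i) := by
  simp [Finset.expect, map_sum, map_nnrat_smul]

lemma ev_nonneg (ψ : D → ℂ) {X : Matrix D D ℂ} (hX : 0 ≤ X) : 0 ≤ ev ψ X := by
  have h := (Matrix.nonneg_iff_posSemidef.1 hX).dotProduct_mulVec_nonneg ψ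
  exact (Complex.le_def.1 h).1

lemma ev_mono (ψ : D → ℂ) {X Y : Matrix D D ℂ} (h : X ≤ Y) : ev ψ X ≤ ev ψ Y := by
  have := ev_nonneg ψ (sub_nonneg.2 h)
  rw [map_sub] at this
  linarith

lemma ev_star (ψ : D → ℂ) (X : Matrix D D ℂ) : ev ψ (star X) = ev ψ X := by
  have : star (star ψ ⬝ᵥ (X *ᵥ ψ)) = star ψ ⬝ᵥ (star X *ᵥ ψ) := by
    rw [Matrix.star_dotProduct, star_star, Matrix.star_mulVec, Matrix.star_eq_conjTranspose,
      Matrix.dotProduct_mulVec, dotProduct_comm]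
  change (star ψ ⬝ᵥ (star X *ᵥ ψ)).re = (star ψ ⬝ᵥ (X *ᵥ ψ)).re
  rw [← this]
  simp

/-- The squared length of `√W X ψ`. -/
noncomputable def wn (ψ : D → ℂ) (W X : Matrix D D ℂ) : ℝ := ev ψ (star X * W * X)

variable (ψ : D → ℂ) {W : Matrix D D ℂ}

lemma wn_nonneg (hW : 0 ≤ W) (X : Matrix D D ℂ) : 0 ≤ wn ψ W X :=
  ev_nonneg ψ (star_left_conjugate_nonneg hW X)

lemma wn_mono {W' : Matrix D D ℂ} (h : W ≤ W') (X : Matrix D D ℂ) : wn ψ W X ≤ wn ψ W' X :=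
  ev_mono ψ (star_left_conjugate_le_conjugate h X)

lemma wn_neg (X : Matrix D D ℂ) : wn ψ W (-X) = wn ψ W X := by
  simp [wn]

lemma wn_sum {ι : Type*} (s : Finset ι) (V : ι → Matrix D D ℂ) (X : Matrix D D ℂ) :
    wn ψ (∑ i ∈ s, V i) X = ∑ i ∈ s, wn ψ (V i) X := by
  simp [wn, Finset.mul_sum, Finset.sum_mul, map_sum]

lemma ev_cross_symm (hW : 0 ≤ W) (X Y : Matrix D D ℂ) :
    ev ψ (star Y * W * X) = ev ψ (star X * W * Y) := by
  rw [← ev_star]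
  simp [mul_assoc, (IsSelfAdjoint.of_nonneg hW).star_eq]

lemma wn_add (hW : 0 ≤ W) (X Y : Matrix D D ℂ) :
    wn ψ W (X + Y) = wn ψ W X + wn ψ W Y + 2 * ev ψ (star X * W * Y) := by
  have := ev_cross_symm ψ hW X Y
  simp only [wn, star_add, add_mul, mul_add, map_add]
  linarith

lemma wn_sub (hW : 0 ≤ W) (X Y : Matrix D D ℂ) :
    wn ψ W (X - Y) = wn ψ W X + wn ψ W Y - 2 * ev ψ (star X * W * Y) := by
  rw [sub_eq_add_neg, wn_add ψ hW, wn_neg]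
  simp
  ring

lemma wn_smul (c : ℝ) (X : Matrix D D ℂ) : wn ψ W (c • X) = c ^ 2 * wn ψ W X := by
  simp only [wn, star_smul, star_trivial, smul_mul_assoc, mul_smul_comm, map_smul, smul_eq_mul]
  ring

lemma wn_add_le (hW : 0 ≤ W) (X Y : Matrix D D ℂ) :
    wn ψ W (X + Y) ≤ 2 * wn ψ W X + 2 * wn ψ W Y := by
  have h1 := wn_nonneg ψ hW (X - Y)
  rw [wn_sub ψ hW] at h1
  rw [wn_add ψ hW]
  linarith

lemma wn_sub_comm (X Y : Matrix D D ℂ) : wn ψ W (X - Y) = wn ψ W (Y - X) := by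
  rw [← wn_neg, neg_sub]

/-- Cauchy-Schwarz combined with the arithmetic-geometric mean inequality. The free parameter `c`
avoids square roots, so that the bound can be summed and averaged before `c` is chosen. -/
lemma ev_cross_le (hW : 0 ≤ W) {c : ℝ} (hc : 0 < c) (X Y : Matrix D D ℂ) :
    ev ψ (star X * W * Y) ≤ c / 2 * wn ψ W X + 1 / (2 * c) * wn ψ W Y := by
  have h1 := wn_nonneg ψ hW (c • X - Y)
  rw [wn_sub ψ hW, wn_smul] at h1
  have h2 : ev ψ (star (c • X) * W * Y) = c * ev ψ (star X * W * Y) := by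
    simp
  rw [h2] at h1
  have : ev ψ (star X * W * Y) * (2 * c) ≤ c ^ 2 * wn ψ W X + wn ψ W Y := by linarith
  rw [← le_div_iff₀ (by positivity)] at this
  refine this.trans (le_of_eq ?_)
  field_simp

lemma abs_ev_cross_le (hW : 0 ≤ W) {c : ℝ} (hc : 0 < c) (X Y : Matrix D D ℂ) :
    |ev ψ (star X * W * Y)| ≤ c / 2 * wn ψ W X + 1 / (2 * c) * wn ψ W Y := by
  rw [abs_le]
  have h := ev_cross_le ψ hW hc (-X) Y
  rw [wn_neg] at h
  simp only [star_neg, neg_mul, map_neg] at h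
  exact ⟨by linarith, ev_cross_le ψ hW hc X Y⟩

/-- Since `C` commutes with `W`, the seminorm splits orthogonally, and the difference of the two
sides is the contribution of `(1 - C) * X`. -/
lemma wn_projection_mul_le [DecidableEq D] (hW : 0 ≤ W) {C : Matrix D D ℂ} (hC : IsSelfAdjoint C)
    (hCC : C * C = C) (hcomm : Commute C W) (X : Matrix D D ℂ) :
    wn ψ W (C * X) ≤ wn ψ W X := by
  have h0 := wn_nonneg ψ hW ((1 - C) * X)
  have h1 : star (C * X) * W * (C * X) = star X * (C * W) * X := by
    simp only [star_mul, hC.star_eq, mul_assoc]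
    rw [← mul_assoc W C X, ← hcomm.eq, ← mul_assoc C (C * W), ← mul_assoc C C, hCC, mul_assoc]
  have h2 : star ((1 - C) * X) * W * ((1 - C) * X) = star X * W * X - star X * (C * W) * X := by
    have key : (1 - C) * W * (1 - C) = W - C * W := by
      have : C * W * C = C * W := by rw [mul_assoc, ← hcomm.eq, ← mul_assoc, hCC]
      simp only [sub_mul, mul_sub, one_mul, mul_one, this, ← hcomm.eq]
      abel
    rw [← sub_mul, ← mul_sub, ← key]
    simp only [star_mul, star_sub, star_one, hC.star_eq, mul_assoc]
  rw [wn, h2, map_sub] at h0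
  rw [wn, wn, h1]
  linarith

/-- Outcomes with the same label share the operator `X`, and their weights add up to at most `1`.
This is how the weights coming from `R` are discarded, leaving quantities that the tests measure. -/
lemma sum_wn_fiber_le [DecidableEq D] {ι α : Type*} [Fintype ι] [Fintype α] [DecidableEq α]
    (V : ι → Matrix D D ℂ) (hV : ∀ i, 0 ≤ V i) (hV1 : ∑ i, V i ≤ 1) (f : ι → α)
    (X : α → Matrix D D ℂ) :
    ∑ i, wn ψ (V i) (X (f i)) ≤ ∑ a, wn ψ 1 (X a) := by
  rw [← Finset.sum_fiberwise univ f]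
  refine Finset.sum_le_sum fun a _ => ?_
  calc ∑ i with f i = a, wn ψ (V i) (X (f i)) = ∑ i with f i = a, wn ψ (V i) (X a) :=
        Finset.sum_congr rfl fun i hi => by rw [(Finset.mem_filter.1 hi).2]
    _ = wn ψ (∑ i with f i = a, V i) (X a) := (wn_sum ..).symm
    _ ≤ wn ψ 1 (X a) := wn_mono ψ ((Finset.sum_le_univ_sum_of_nonneg hV).trans hV1) _

end VectorState

/-! ### Variances and the Efron-Stein inequality. -/

section Averages

variable {D : Type v} [Fintype D] (ψ : D → ℂ) {W : Matrix D D ℂ}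

/-- Exchanging `w i` with `t` is a bijection of the pairs `(w, t)`. -/
lemma expect_resample {ι F : Type*} [Fintype ι] [DecidableEq ι] [Fintype F] [Nonempty F]
    [DecidableEq F] (i : ι) (f : (ι → F) → ℝ) :
    𝔼 w : ι → F, 𝔼 t : F, f (Function.update w i t) = 𝔼 w : ι → F, f w := by
  have h1 : 𝔼 w : ι → F, 𝔼 t : F, f (Function.update w i t) =
      𝔼 q : (ι → F) × F, f (Function.update q.1 i q.2) := by
    rw [← univ_product_univ, expect_product]
  have h2 : 𝔼 w : ι → F, f w = 𝔼 q : (ι → F) × F, f q.1 := by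
    rw [← univ_product_univ, expect_product]
    simp
  rw [h1, h2]
  let e : (ι → F) × F ≃ (ι → F) × F :=
    { toFun := fun q => (Function.update q.1 i q.2, q.1 i)
      invFun := fun q => (Function.update q.1 i q.2, q.1 i)
      left_inv := fun q => by simp
      right_inv := fun q => by simp }
  exact Fintype.expect_equiv e _ _ fun q => rfl

lemma expect_fin_cons {F M : Type*} [Fintype F] [AddCommMonoid M] [Module ℚ≥0 M] {k : ℕ}
    (f : (Fin (k + 1) → F) → M) :
    𝔼 w, f w = 𝔼 t : F, 𝔼 w : Fin k → F, f (Fin.cons t w) := by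
  classical
  rw [← expect_product', univ_product_univ]
  exact (Fintype.expect_equiv (Fin.consEquiv fun _ => F) _ _ fun q => rfl).symm

lemma wn_sub_expect_right {ι : Type*} [Fintype ι] [Nonempty ι] (hW : 0 ≤ W)
    (u : ι → Matrix D D ℂ) (Y : Matrix D D ℂ) :
    𝔼 i, wn ψ W (u i - Y) =
      𝔼 i, wn ψ W (u i) + wn ψ W Y - 2 * ev ψ (star (𝔼 i, u i) * W * Y) := by
  have h : ev ψ (star (𝔼 i, u i) * W * Y) = 𝔼 i, ev ψ (star (u i) * W * Y) := by
    have := map_expect_of_additive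
      ((ev ψ).toAddMonoidHom.comp ((AddMonoidHom.mulRight Y).comp
        ((AddMonoidHom.mulRight W).comp (starAddEquiv (R := Matrix D D ℂ)).toAddMonoidHom)))
      univ u
    simpa using this
  rw [h]
  simp only [wn_sub ψ hW, expect_sub_distrib, expect_add_distrib, Fintype.expect_const,
    mul_expect]

/-- The bias-variance decomposition. -/
lemma expect_wn_sub_expect {ι : Type*} [Fintype ι] [Nonempty ι] (hW : 0 ≤ W)
    (u : ι → Matrix D D ℂ) (c : Matrix D D ℂ) :
    𝔼 i, wn ψ W (u i - c) = 𝔼 i, wn ψ W (u i - 𝔼 j, u j) + wn ψ W (𝔼 j, u j - c) := by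
  rw [wn_sub_expect_right ψ hW, wn_sub_expect_right ψ hW, wn_sub ψ hW]
  have : ev ψ (star (𝔼 i, u i) * W * 𝔼 i, u i) = wn ψ W (𝔼 i, u i) := rfl
  rw [this]
  ring

lemma wn_expect_le {ι : Type*} [Fintype ι] [Nonempty ι] (hW : 0 ≤ W) (u : ι → Matrix D D ℂ) :
    wn ψ W (𝔼 i, u i) ≤ 𝔼 i, wn ψ W (u i) := by
  have h := expect_wn_sub_expect ψ hW u 0
  have h0 : 0 ≤ 𝔼 i, wn ψ W (u i - 𝔼 j, u j) := expect_nonneg fun i _ => wn_nonneg ψ hW _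
  simp only [sub_zero] at h
  linarith

lemma expect_expect_wn_sub {ι : Type*} [Fintype ι] [Nonempty ι] (hW : 0 ≤ W)
    (u : ι → Matrix D D ℂ) :
    𝔼 i, 𝔼 j, wn ψ W (u i - u j) = 2 * 𝔼 i, wn ψ W (u i - 𝔼 j, u j) := by
  rw [expect_comm]
  simp_rw [expect_wn_sub_expect ψ hW u (u _)]
  rw [expect_add_distrib, Fintype.expect_const]
  simp_rw [wn_sub_comm ψ (𝔼 j, u j)]
  ring

/-- Efron-Stein by induction on the number of coordinates: the variance is the mean of the variances
conditional on the first coordinate plus the variance of the conditional means. By convexity the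
latter is at most the Dirichlet form of the first coordinate. -/
lemma wn_variance_le_dirichlet {F : Type*} [Fintype F] [Nonempty F] (hW : 0 ≤ W) (k : ℕ)
    (u : (Fin k → F) → Matrix D D ℂ) :
    𝔼 w, wn ψ W (u w - 𝔼 w', u w') ≤
      ∑ i, 1 / 2 * 𝔼 w, 𝔼 t, wn ψ W (u w - u (Function.update w i t)) := by
  classical
  induction k with
  | zero =>
    simp [wn]
  | succ k ih =>
    have h1 : 𝔼 w, wn ψ W (u w - 𝔼 w', u w') =
        𝔼 t : F, 𝔼 w : Fin k → F, wn ψ W (u (Fin.cons t w) - 𝔼 w', u (Fin.cons t w')) +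
        𝔼 t : F, wn ψ W (𝔼 w', u (Fin.cons t w') - 𝔼 w', u w') := by
      rw [expect_fin_cons, ← expect_add_distrib]
      exact expect_congr rfl fun t _ => expect_wn_sub_expect ψ hW _ _
    have h2 : 𝔼 t : F, 𝔼 w : Fin k → F, wn ψ W (u (Fin.cons t w) - 𝔼 w', u (Fin.cons t w')) ≤
        ∑ i : Fin k, 1 / 2 * 𝔼 w, 𝔼 t, wn ψ W (u w - u (Function.update w i.succ t)) := by
      refine (expect_le_expect fun t _ => ih fun w => u (Fin.cons t w)).trans (le_of_eq ?_)
      rw [expect_sum_comm]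
      refine sum_congr rfl fun i _ => ?_
      rw [← mul_expect, expect_fin_cons]
      simp_rw [Fin.cons_update]
    have h3 : 𝔼 t : F, wn ψ W (𝔼 w', u (Fin.cons t w') - 𝔼 w', u w') ≤
        1 / 2 * 𝔼 w, 𝔼 t, wn ψ W (u w - u (Function.update w 0 t)) := by
      have h4 := expect_expect_wn_sub ψ hW fun t : F => 𝔼 w' : Fin k → F, u (Fin.cons t w')
      rw [expect_fin_cons u]
      have h5 : 𝔼 t : F, 𝔼 t' : F, wn ψ W (𝔼 w : Fin k → F, u (Fin.cons t w) -
          𝔼 w : Fin k → F, u (Fin.cons t' w)) ≤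
          𝔼 w, 𝔼 t, wn ψ W (u w - u (Function.update w 0 t)) := by
        rw [expect_fin_cons]
        refine expect_le_expect fun t _ => ?_
        rw [expect_comm]
        refine expect_le_expect fun t' _ => ?_
        rw [← expect_sub_distrib]
        simp_rw [Fin.update_cons_zero]
        exact wn_expect_le ψ hW _
      linarith
    rw [h1, Fin.sum_univ_succ]
    linarith

end Averages

/-! ### The spread along one line. -/

section Line

variable {d : Type v} [Fintype d] [DecidableEq d] (ψ : d × d × d → ℂ)

lemma reg1_nonneg {X : Matrix d d ℂ} (hX : 0 ≤ X) : 0 ≤ reg1 X := map_nonneg reg1 hX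

lemma reg2_nonneg {X : Matrix d d ℂ} (hX : 0 ≤ X) : 0 ≤ reg2 X := map_nonneg reg2 hX

lemma reg1_mul_reg2_nonneg {X Y : Matrix d d ℂ} (hX : 0 ≤ X) (hY : 0 ≤ Y) :
    0 ≤ reg1 X * reg2 Y := by
  have : reg1 X * reg2 Y = X ⊗ₖ (Y ⊗ₖ 1) := by simp [reg1, reg2, ← Matrix.mul_kronecker_mul]
  rw [Matrix.nonneg_iff_posSemidef] at *
  rw [this]
  exact hX.kronecker (hY.kronecker Matrix.PosSemidef.one)

omit [Fintype d] [DecidableEq d] in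
lemma expect_matrix_nonneg {ι : Type*} [Fintype ι] {f : ι → Matrix d d ℂ} (hf : ∀ i, 0 ≤ f i) :
    0 ≤ 𝔼 i, f i := by
  rw [expect, ← NNRat.cast_smul_eq_nnqsmul ℝ]
  have h := Matrix.nonneg_iff_posSemidef.1 (sum_nonneg fun i (_ : i ∈ univ) => hf i)
  exact Matrix.nonneg_iff_posSemidef.2 (h.smul (by positivity))

lemma reg2_real_smul (r : ℝ) (X : Matrix d d ℂ) : reg2 (r • X) = r • reg2 X := by
  have h1 : r • X = (r : ℂ) • X := by ext; simp
  have h2 : r • reg2 X = (r : ℂ) • reg2 X := by ext; simp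
  rw [h1, h2, map_smul]

lemma wn_reg1_reg2 {R : Matrix d d ℂ} (Y : Matrix d d ℂ) :
    wn ψ (reg1 R) (reg2 Y) = ev ψ (reg1 R * reg2 (star Y * Y)) := by
  rw [wn, ← map_star, ← (commute_reg1_reg2 R (star Y)).eq, mul_assoc, ← map_mul]

lemma ev_reg1_reg2_cross {R : Matrix d d ℂ} (X Y : Matrix d d ℂ) :
    ev ψ (star (reg2 X) * reg1 R * reg2 Y) = ev ψ (reg1 R * reg2 (star X * Y)) := by
  rw [← map_star, ← (commute_reg1_reg2 R (star X)).eq, mul_assoc, ← map_mul]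

/-- An operator form of the inequality `b - b² ≤ s (1 - b) + b² (1 - b) / s`. -/
lemma ev_one_sub_mul_self_le {R B : Matrix d d ℂ} (hR : 0 ≤ R) (hB : star B = B)
    (hB1 : 0 ≤ 1 - B) {s : ℝ} (hs : 0 < s) :
    ev ψ (reg1 R * reg2 ((1 - B) * B)) ≤ s * ev ψ (reg1 R * reg2 (1 - B)) +
      1 / s * ev ψ (reg1 R * reg2 (B * (1 - B) * B)) := by
  have h1 := ev_nonneg ψ (reg1_mul_reg2_nonneg hR hB1)
  -- Conjugating `1 - B ≥ 0` by `B - s/2` gives `(b - s/2)² (1 - b) ≥ 0`, that is, `s b (1 - b) ≤ b²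
  -- (1 - b) + (s²/4)(1 - b)`.
  have h2 := ev_nonneg ψ (reg1_mul_reg2_nonneg hR
    (star_left_conjugate_nonneg hB1 (B - (s / 2) • 1)))
  have h3 : star (B - (s / 2) • (1 : Matrix d d ℂ)) * (1 - B) * (B - (s / 2) • 1) =
      B * (1 - B) * B - s • ((1 - B) * B) + (s / 2) ^ 2 • (1 - B) := by
    rw [star_sub, star_smul, star_one, hB, star_trivial]
    simp only [sub_mul, mul_sub, smul_mul_assoc, mul_smul_comm, one_mul, mul_one]
    module
  have key : ∀ X : Matrix d d ℂ, ∀ r : ℝ, ev ψ (reg1 R * reg2 (r • X)) =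
      r * ev ψ (reg1 R * reg2 X) := fun X r => by
    rw [reg2_real_smul, mul_smul_comm, map_smul, smul_eq_mul]
  rw [h3, map_add, map_sub, mul_add, mul_sub, map_add, map_sub, key, key] at h2
  rw [div_mul_eq_mul_div, one_mul, ← sub_le_iff_le_add', le_div_iff₀ hs]
  nlinarith [mul_nonneg (sq_nonneg s) h1]

/-- The estimate behind the linearity test for a single operator `R` on the first register and
three projections: `P` and `Q` force `P'` up to the right-hand side. -/
lemma ev_three_projections_le {R P P' Q : Matrix d d ℂ} (hR : 0 ≤ R) (hP : IsStarProjection P)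
    (hP' : IsStarProjection P') (hQ : IsStarProjection Q) {c : ℝ} (hc : 0 < c) :
    ev ψ (reg1 R * reg2 (P * (1 - P') * Q)) ≤ c * wn ψ (reg1 R) 1 +
      1 / (2 * c) * (wn ψ (reg1 R) (reg2 Q - reg3 Q) + 2 * wn ψ (reg1 R) (reg1 P - reg2 P) +
        2 * wn ψ (reg1 R) (reg3 Q * reg2 (1 - P') * reg1 P)) := by
  have hW := reg1_nonneg hR
  have hC := hP'.one_sub
  have c2 : ∀ X : Matrix d d ℂ, Commute (reg2 X) (reg1 R) := fun X => (commute_reg1_reg2 R X).symm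
  have c3 : Commute (reg3 Q) (reg1 R) := (commute_reg1_reg3 R Q).symm
  have pr2 : ∀ {Z : Matrix d d ℂ}, IsStarProjection Z → ∀ X,
      wn ψ (reg1 R) (reg2 Z * X) ≤ wn ψ (reg1 R) X := fun hZ X =>
    wn_projection_mul_le ψ hW (hZ.map reg2).isSelfAdjoint (hZ.map reg2).isIdempotentElem.eq (c2 _) X
  have pr3 : ∀ X, wn ψ (reg1 R) (reg3 Q * X) ≤ wn ψ (reg1 R) X := fun X =>
    wn_projection_mul_le ψ hW (hQ.map reg3).isSelfAdjoint (hQ.map reg3).isIdempotentElem.eq c3 X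
  set X : Matrix (d × d × d) (d × d × d) ℂ := reg2 ((1 - P') * P) with hX
  -- Two operators leave the second register: `Q` goes to the third here, and `P` to the first in
  -- `e5`. What remains is the joint event of three players, with `P` acting on `ψ` before the
  -- weight `R`, so that `P` and `R` need not commute.
  have e1 : ev ψ (reg1 R * reg2 (P * (1 - P') * Q)) =
      ev ψ (star X * reg1 R * (reg2 Q - reg3 Q)) + ev ψ (star (reg3 Q * X) * reg1 R * 1) := by
    have : star (reg3 Q * X) * reg1 R * 1 = star X * reg1 R * reg3 Q := by
      rw [star_mul, (hQ.map reg3).isSelfAdjoint.star_eq, mul_one, mul_assoc, c3.eq, mul_assoc]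
    rw [this, mul_sub (star X * reg1 R), map_sub (ev ψ), sub_add_cancel, hX,
      ev_reg1_reg2_cross, star_mul,
      hC.isSelfAdjoint.star_eq, hP.isSelfAdjoint.star_eq]
  have e2 := ev_cross_le ψ hW hc X (reg2 Q - reg3 Q)
  have e3 := ev_cross_le ψ hW hc 1 (reg3 Q * X)
  rw [ev_cross_symm ψ hW] at e3
  have e4 : wn ψ (reg1 R) X ≤ wn ψ (reg1 R) 1 := by
    rw [hX, map_mul]
    refine (pr2 hC _).trans ?_
    have := pr2 hP 1
    rwa [mul_one] at this
  have e5 : wn ψ (reg1 R) (reg3 Q * X) ≤ 2 * wn ψ (reg1 R) (reg1 P - reg2 P) +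
      2 * wn ψ (reg1 R) (reg3 Q * reg2 (1 - P') * reg1 P) := by
    have : reg3 Q * X = reg3 Q * (reg2 (1 - P') * (reg2 P - reg1 P)) +
        reg3 Q * reg2 (1 - P') * reg1 P := by
      rw [hX, map_mul, mul_sub, mul_sub, mul_assoc]
      abel
    rw [this]
    refine (wn_add_le ψ hW _ _).trans ?_
    have := (pr3 _).trans (pr2 hC (reg2 P - reg1 P))
    rw [wn_sub_comm ψ (reg1 P)]
    linarith
  rw [e1]
  have hc2 : 0 ≤ c / 2 := by positivity
  have hc3 : 0 ≤ 1 / (2 * c) := by positivity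
  have := mul_le_mul_of_nonneg_left e4 hc2
  have := mul_le_mul_of_nonneg_left e5 hc3
  linarith

/-- The condition `4 / N ≤ s` makes the copy of `V` on the right, after division by `s`, at most `V
/ 2`, so it can be moved to the left. -/
lemma absorb_le {V I Q E s N : ℝ} (hs : 0 < s) (hsN : 4 / N ≤ s) (hV : 0 ≤ V)
    (h1 : V ≤ s * I + 1 / s * Q) (h2 : Q ≤ 1 / N * (2 * V) + E) :
    2 * V ≤ 4 * s * I + 4 / s * E := by
  have h3 : 1 / N * (2 * V) ≤ s / 4 * (2 * V) :=
    mul_le_mul_of_nonneg_right (by linarith [show 4 / N = 4 * (1 / N) by ring]) (by positivity)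
  have h4 : 1 / s * Q ≤ 1 / s * (s / 4 * (2 * V) + E) := by
    gcongr
    linarith
  have h5 : 1 / s * (s / 4 * (2 * V) + E) = V / 2 + 1 / s * E := by
    field_simp
    ring
  have h6 : 4 / s * E = 4 * (1 / s * E) := by ring
  rw [h6]
  linarith

/-- Operators `p t g` on the points `t` of a line: an average with small spread between `0` and `1`
can be controlled by the linearity test. -/
lemma line_spread_le {T G : Type*} [Fintype T] [Nonempty T] [DecidableEq T] [Fintype G]
    {R : G → Matrix d d ℂ} (hR : ∀ g, 0 ≤ R g) {p : T → G → Matrix d d ℂ}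
    (hp : ∀ t g, IsStarProjection (p t g)) {c s : ℝ} (hc : 0 < c) (hs : 0 < s)
    (hsT : 4 / (Fintype.card T : ℝ) ≤ s) (κ : T → ℝ) (fail : T → T → T → ℝ)
    (hR1 : ∑ g, wn ψ (reg1 (R g)) 1 ≤ 1)
    (hκ0 : ∀ t, 0 ≤ κ t) (hfail0 : ∀ t t' t'', 0 ≤ fail t t' t'')
    (hκ23 : ∀ t, ∑ g, wn ψ (reg1 (R g)) (reg2 (p t g) - reg3 (p t g)) ≤ κ t)
    (hκ12 : ∀ t, ∑ g, wn ψ (reg1 (R g)) (reg1 (p t g) - reg2 (p t g)) ≤ κ t)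
    (hfail : ∀ t t' t'', t ≠ t' → t' ≠ t'' → t ≠ t'' →
      ∑ g, wn ψ (reg1 (R g)) (reg3 (p t'' g) * reg2 (1 - p t' g) * reg1 (p t g)) ≤ fail t t' t'') :
    𝔼 t, 𝔼 t', ∑ g, wn ψ (reg1 (R g)) (reg2 (p t g) - reg2 (p t' g)) ≤
      4 * s * 𝔼 t, ∑ g, ev ψ (reg1 (R g) * reg2 (1 - p t g)) +
      4 / s * (c + 1 / (2 * c) * (3 * 𝔼 t, κ t + 2 * 𝔼 t, 𝔼 t', 𝔼 t'', fail t t' t'')) := by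
  set τ : T → T → T → ℝ := fun t t' t'' =>
    ∑ g, ev ψ (reg1 (R g) * reg2 (p t g * (1 - p t' g) * p t'' g)) with hτ
  set N : T → T → ℝ := fun t t' => ∑ g, wn ψ (reg1 (R g)) (reg2 (p t g) - reg2 (p t' g)) with hN
  have hN0 : ∀ t t', 0 ≤ N t t' := fun t t' =>
    sum_nonneg fun g _ => wn_nonneg ψ (reg1_nonneg (hR g)) _
  have hτle : ∀ t t' t'', τ t t' t'' ≤ (if t'' = t then N t t' else 0) +
      (c + 1 / (2 * c) * (κ t'' + 2 * κ t + 2 * fail t t' t'')) := by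
    intro t t' t''
    have hpos : 0 ≤ c + 1 / (2 * c) * (κ t'' + 2 * κ t + 2 * fail t t' t'') := by
      have := hκ0 t; have := hκ0 t''; have := hfail0 t t' t''
      positivity
    -- Here the linearity test gives nothing, but `p_t (1 - p_{t'}) p_t` is bounded by the squared
    -- distance of `p_t` and `p_{t'}`. The other two coincidences make the product of projections
    -- vanish.
    by_cases h1 : t'' = t
    · subst h1
      have : τ t'' t' t'' ≤ N t'' t' := by
        refine sum_le_sum fun g _ => ?_
        have hC := (hp t' g).one_sub
        have h2 := wn_projection_mul_le ψ (reg1_nonneg (hR g)) (hC.map reg2).isSelfAdjoint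
          (hC.map reg2).isIdempotentElem.eq (commute_reg1_reg2 (R g) _).symm
          (reg2 (p t'' g) - reg2 (p t' g))
        refine (le_of_eq ?_).trans h2
        rw [← map_sub, ← map_mul, mul_sub (1 - p t' g),
          (hp t' g).isIdempotentElem.one_sub_mul_self, sub_zero,
          wn_reg1_reg2, star_mul, hC.isSelfAdjoint.star_eq, (hp t'' g).isSelfAdjoint.star_eq,
          ← mul_assoc, mul_assoc (p t'' g) (1 - p t' g) (1 - p t' g), hC.isIdempotentElem.eq]
      rw [if_pos rfl]
      linarith
    rw [if_neg h1, zero_add]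
    by_cases h2 : t = t'
    · subst h2
      refine le_trans (le_of_eq (sum_eq_zero fun g _ => ?_)) hpos
      rw [(hp t g).isIdempotentElem.mul_one_sub_self]
      simp
    by_cases h3 : t' = t''
    · subst h3
      refine le_trans (le_of_eq (sum_eq_zero fun g _ => ?_)) hpos
      rw [mul_assoc, (hp t' g).isIdempotentElem.one_sub_mul_self]
      simp
    have h4 := sum_le_sum fun g (_ : g ∈ univ) =>
      ev_three_projections_le ψ (hR g) (hp t g) (hp t' g) (hp t'' g) hc
    refine h4.trans ?_
    rw [sum_add_distrib, ← mul_sum, ← mul_sum, sum_add_distrib, sum_add_distrib, ← mul_sum,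
      ← mul_sum]
    have h5 : c * ∑ g, wn ψ (reg1 (R g)) 1 ≤ c * 1 := by gcongr
    have h6 := hκ23 t''
    have h7 := hκ12 t
    have h8 := hfail t t' t'' h2 h3 (Ne.symm h1)
    rw [mul_one] at h5
    gcongr
  set B : G → Matrix d d ℂ := fun g => 𝔼 t, p t g with hB
  set V : ℝ := ∑ g, ev ψ (reg1 (R g) * reg2 ((1 - B g) * B g)) with hV
  have lin2 : ∀ g (f : T → Matrix d d ℂ), ev ψ (reg1 (R g) * reg2 (𝔼 t, f t)) =
      𝔼 t, ev ψ (reg1 (R g) * reg2 (f t)) := fun g f => by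
    simpa using map_expect_of_additive ((ev ψ).toAddMonoidHom.comp
      ((AddMonoidHom.mulLeft (reg1 (R g))).comp
        (reg2 : Matrix d d ℂ →⋆ₐ[ℂ] _).toAlgHom.toRingHom.toAddMonoidHom)) univ f
  have oneB : ∀ g, 1 - B g = 𝔼 t, (1 - p t g) := fun g => by
    rw [expect_sub_distrib, Fintype.expect_const]
  have starB : ∀ g, star (B g) = B g := fun g => by
    have := map_expect_of_additive (starAddEquiv (R := Matrix d d ℂ)) univ fun t => p t g
    simp only [starAddEquiv_apply, (hp _ g).isSelfAdjoint.star_eq] at this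
    exact this
  have regB : ∀ g, 𝔼 t, reg2 (p t g) = reg2 (B g) := fun g =>
    (map_expect_of_additive (reg2 : Matrix d d ℂ →⋆ₐ[ℂ] _) univ fun t => p t g).symm
  -- For projections the mean of the squares is `B`, so the variance is `B - B²`; the mean over
  -- pairs is twice the variance.
  have hNV : 𝔼 t, 𝔼 t', N t t' = 2 * V := by
    have h1 : 𝔼 t, 𝔼 t', N t t' =
        ∑ g, 𝔼 t, 𝔼 t', wn ψ (reg1 (R g)) (reg2 (p t g) - reg2 (p t' g)) := by
      simp only [hN, expect_sum_comm]
    rw [h1, hV, mul_sum]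
    refine sum_congr rfl fun g _ => ?_
    have h2 := expect_wn_sub_expect ψ (reg1_nonneg (hR g)) (fun t => reg2 (p t g)) 0
    rw [expect_expect_wn_sub ψ (reg1_nonneg (hR g))]
    simp only [sub_zero, regB, wn_reg1_reg2, starB, (hp _ g).isSelfAdjoint.star_eq,
      (hp _ g).isIdempotentElem.eq, ← lin2] at h2 ⊢
    rw [sub_mul, one_mul, map_sub, mul_sub, map_sub, h2]
    ring
  have hQ : ∑ g, ev ψ (reg1 (R g) * reg2 (B g * (1 - B g) * B g)) =
      𝔼 t, 𝔼 t', 𝔼 t'', τ t t' t'' := by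
    simp only [hτ, expect_sum_comm, ← lin2]
    refine sum_congr rfl fun g _ => ?_
    rw [oneB]
    simp only [hB, ← mul_expect, ← expect_mul]
  have hB1 : ∀ g, 0 ≤ 1 - B g := fun g => by
    rw [oneB]
    exact expect_matrix_nonneg fun t => (hp t g).one_sub.nonneg
  have hVle : V ≤ s * ∑ g, ev ψ (reg1 (R g) * reg2 (1 - B g)) +
      1 / s * ∑ g, ev ψ (reg1 (R g) * reg2 (B g * (1 - B g) * B g)) := by
    rw [hV, mul_sum, mul_sum, ← sum_add_distrib]
    exact sum_le_sum fun g _ => ev_one_sub_mul_self_le ψ (hR g) (starB g) (hB1 g) hs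
  have hQle : 𝔼 t, 𝔼 t', 𝔼 t'', τ t t' t'' ≤ 1 / (Fintype.card T : ℝ) * (2 * V) +
      (c + 1 / (2 * c) * (3 * 𝔼 t, κ t + 2 * 𝔼 t, 𝔼 t', 𝔼 t'', fail t t' t'')) := by
    refine (expect_le_expect fun t _ => expect_le_expect fun t' _ => expect_le_expect
      fun t'' _ => hτle t t' t'').trans (le_of_eq ?_)
    have h1 : ∀ t t', 𝔼 t'', (if t'' = t then N t t' else 0) =
        1 / (Fintype.card T : ℝ) * N t t' := fun t t' => by
      rw [Fintype.expect_eq_sum_div_card, sum_ite_eq' univ t, if_pos (mem_univ _)]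
      ring
    simp only [expect_add_distrib, h1, ← mul_expect, Fintype.expect_const, hNV]
    ring
  have hV0 : 0 ≤ V := by
    have : 0 ≤ 𝔼 t, 𝔼 t', N t t' := expect_nonneg fun t _ => expect_nonneg fun t' _ => hN0 t t'
    linarith
  have hI : ∑ g, ev ψ (reg1 (R g) * reg2 (1 - B g)) =
      𝔼 t, ∑ g, ev ψ (reg1 (R g) * reg2 (1 - p t g)) := by
    simp only [expect_sum_comm, oneB, lin2]
  rw [hNV, ← hI]
  rw [hQ] at hVle
  exact absorb_le hs hsT hV0 hVle hQle

end Line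

/-! ### Expectation values in terms of registers. -/

section Expectations

variable {d : Type v} [Fintype d] [DecidableEq d] (ψ : d × d × d → ℂ)

lemma reg1_mul_reg2_mul_reg3 (X Y Z : Matrix d d ℂ) :
    reg1 X * reg2 Y * reg3 Z = X ⊗ₖ (Y ⊗ₖ Z) := by
  simp [reg1, reg2, reg3, ← Matrix.mul_kronecker_mul]

lemma re_expVal (X Y Z : Matrix d d ℂ) :
    (expVal ψ X Y Z).re = ev ψ (reg1 X * reg2 Y * reg3 Z) := by
  rw [reg1_mul_reg2_mul_reg3]
  rfl

lemma trRho_eq_ev (X Y : Matrix d d ℂ) : trRho ψ X Y = ev ψ (reg1 X * reg2 Y) := by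
  rw [trRho, re_expVal, map_one, mul_one]

lemma rhoNormSq_eq_ev (X : Matrix d d ℂ) : rhoNormSq ψ X = ev ψ (reg1 (X * star X)) := by
  rw [rhoNormSq, re_expVal, map_one, mul_one, map_one, mul_one, Matrix.star_eq_conjTranspose]

lemma reg_mul_nonneg {X Y Z : Matrix d d ℂ} (hX : 0 ≤ X) (hY : 0 ≤ Y) (hZ : 0 ≤ Z) :
    0 ≤ reg1 X * reg2 Y * reg3 Z := by
  rw [Matrix.nonneg_iff_posSemidef] at *
  rw [reg1_mul_reg2_mul_reg3]
  exact hX.kronecker (hY.kronecker hZ)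

lemma re_expVal_nonneg {X Y Z : Matrix d d ℂ} (hX : 0 ≤ X) (hY : 0 ≤ Y) (hZ : 0 ≤ Z) :
    0 ≤ (expVal ψ X Y Z).re := by
  rw [re_expVal]
  exact ev_nonneg ψ (reg_mul_nonneg hX hY hZ)

lemma wn_one_reg_product {P P' Q : Matrix d d ℂ} (hP : IsStarProjection P)
    (hP' : IsStarProjection P') (hQ : IsStarProjection Q) :
    wn ψ 1 (reg3 Q * reg2 P' * reg1 P) = (expVal ψ P P' Q).re := by
  have h : reg3 Q * reg2 P' * reg1 P = reg1 P * reg2 P' * reg3 Q := by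
    rw [← (commute_reg2_reg3 P' Q).eq, mul_assoc, ← (commute_reg1_reg3 P Q).eq, ← mul_assoc,
      ← (commute_reg1_reg2 P P').eq]
  rw [wn, re_expVal, h, mul_one, reg1_mul_reg2_mul_reg3, Matrix.star_eq_conjTranspose,
    Matrix.conjTranspose_kronecker, Matrix.conjTranspose_kronecker, ← Matrix.mul_kronecker_mul,
    ← Matrix.mul_kronecker_mul]
  simp only [← Matrix.star_eq_conjTranspose, hP.isSelfAdjoint.star_eq, hP'.isSelfAdjoint.star_eq,
    hQ.isSelfAdjoint.star_eq, hP.isIdempotentElem.eq, hP'.isIdempotentElem.eq,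
    hQ.isIdempotentElem.eq]

end Expectations

/-! ### What the two tests say about the measurements. -/

namespace Strategy

variable {F : Type u} [Fintype F] {d : Type v} [Fintype d] [DecidableEq d] {n : ℕ}
  (S : Strategy F d n)

lemma isStarProjection (x : Fin n → F) (a : F) : IsStarProjection (S.A x a) :=
  ⟨S.projector x a, (S.posSemidef x a).isHermitian⟩

lemma A_nonneg (x : Fin n → F) (a : F) : 0 ≤ S.A x a := (S.isStarProjection x a).nonneg

lemma ev_one : ev S.ψ 1 = 1 := by
  simp [ev, S.norm_eq_one]

/-- The failure probability in the consistency test at the point `x`, up to a factor `2`. -/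
noncomputable def defect (x : Fin n → F) : ℝ :=
  2 - 2 * ∑ a, (expVal S.ψ (S.A x a) (S.A x a) (S.A x a)).re

/-- For projections summing to `1`, the sum of the squared distances is `2` minus twice the
probability that the two registers agree, and `h` bounds this agreement below by that of all three.
-/
lemma sum_wn_le_defect_of {r r' : Matrix d d ℂ →⋆ₐ[ℂ] Matrix (d × d × d) (d × d × d) ℂ}
    (x : Fin n → F)
    (h : ∀ a, ev S.ψ (reg1 (S.A x a) * reg2 (S.A x a) * reg3 (S.A x a)) ≤
      ev S.ψ (r (S.A x a) * r' (S.A x a))) :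
    ∑ a, wn S.ψ 1 (r (S.A x a) - r' (S.A x a)) ≤ S.defect x := by
  have h1 : ∀ a, wn S.ψ 1 (r (S.A x a) - r' (S.A x a)) =
      ev S.ψ (r (S.A x a)) + ev S.ψ (r' (S.A x a)) - 2 * ev S.ψ (r (S.A x a) * r' (S.A x a)) := by
    intro a
    have hp := (S.isStarProjection x a)
    rw [wn_sub S.ψ zero_le_one, wn, wn]
    simp only [← map_star, hp.isSelfAdjoint.star_eq, mul_one, ← map_mul, hp.isIdempotentElem.eq]
  have h2 : ∀ q : Matrix d d ℂ →⋆ₐ[ℂ] Matrix (d × d × d) (d × d × d) ℂ,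
      ∑ a, ev S.ψ (q (S.A x a)) = 1 := fun q => by
    rw [← map_sum, ← map_sum, S.sum_eq_one, map_one, S.ev_one]
  simp only [h1, sum_sub_distrib, sum_add_distrib, h2, ← mul_sum, defect, re_expVal]
  linarith [sum_le_sum fun a (_ : a ∈ univ) => h a]

lemma sum_wn_reg1_sub_reg2_le (x : Fin n → F) :
    ∑ a, wn S.ψ 1 (reg1 (S.A x a) - reg2 (S.A x a)) ≤ S.defect x := by
  refine S.sum_wn_le_defect_of x fun a => ?_
  have := ev_nonneg S.ψ (reg_mul_nonneg (S.A_nonneg x a) (S.A_nonneg x a)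
    (S.isStarProjection x a).one_sub.nonneg)
  rw [map_sub, mul_sub, map_sub, map_one, mul_one] at this
  linarith

lemma sum_wn_reg2_sub_reg3_le (x : Fin n → F) :
    ∑ a, wn S.ψ 1 (reg2 (S.A x a) - reg3 (S.A x a)) ≤ S.defect x := by
  refine S.sum_wn_le_defect_of x fun a => ?_
  have := ev_nonneg S.ψ (reg_mul_nonneg (S.isStarProjection x a).one_sub.nonneg
    (S.A_nonneg x a) (S.A_nonneg x a))
  rw [map_sub, sub_mul, sub_mul, map_sub, map_one, one_mul] at this
  linarith

lemma defect_nonneg (x : Fin n → F) : 0 ≤ S.defect x :=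
  (sum_nonneg fun _ _ => wn_nonneg S.ψ zero_le_one _).trans (S.sum_wn_reg1_sub_reg2_le x)

lemma expect_defect [Nonempty F] : 𝔼 x, S.defect x = 2 - 2 * S.consProb := by
  simp only [defect, expect_sub_distrib, ← mul_expect, Fintype.expect_const, consProb]

lemma consProb_le_one [Nonempty F] : S.consProb ≤ 1 := by
  have h : 0 ≤ 𝔼 x, S.defect x := expect_nonneg fun x _ => S.defect_nonneg x
  rw [expect_defect] at h
  linarith

lemma sum_re_expVal (x y z : Fin n → F) :
    ∑ a, ∑ b, ∑ c, (expVal S.ψ (S.A x a) (S.A y b) (S.A z c)).re = 1 := by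
  simp only [re_expVal, ← map_sum, ← mul_sum, S.sum_eq_one, map_one, mul_one, S.ev_one]

variable [Field F]

open scoped Classical in
/-- The probability of failure in the linearity test for three points on the line through `x` in
direction `i`, with the convention that nothing is tested if the points are not distinct. -/
noncomputable def lineFail (i : Fin n) (x : Fin n → F) (t t' t'' : F) : ℝ :=
  if t' ≠ t ∧ t'' ≠ t ∧ t' ≠ t'' then
    ∑ a, ∑ b, ∑ c, if linAccept t t' t'' a b c then 0 else
      (expVal S.ψ (S.A (Function.update x i t) a) (S.A (Function.update x i t') b)
        (S.A (Function.update x i t'') c)).re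
  else 0

lemma lineFail_nonneg (i : Fin n) (x : Fin n → F) (t t' t'' : F) :
    0 ≤ S.lineFail i x t t' t'' := by
  unfold lineFail
  split_ifs
  · refine sum_nonneg fun a _ => sum_nonneg fun b _ => sum_nonneg fun c _ => ?_
    split_ifs
    · exact le_rfl
    · exact re_expVal_nonneg _ (S.A_nonneg _ _) (S.A_nonneg _ _) (S.A_nonneg _ _)
  · exact le_rfl

lemma lineFail_update (i : Fin n) (x : Fin n → F) (s t t' t'' : F) :
    S.lineFail i (Function.update x i s) t t' t'' = S.lineFail i x t t' t'' := by
  simp [lineFail]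

lemma sum_linChoices_lineFail :
    ∑ q ∈ linChoices F n, S.lineFail q.1 q.2.1 (q.2.1 q.1) q.2.2.1 q.2.2.2 =
      #(linChoices F n) * (1 - S.linProb) := by
  classical
  have h : ∀ q ∈ linChoices F n, S.lineFail q.1 q.2.1 (q.2.1 q.1) q.2.2.1 q.2.2.2 =
      1 - ∑ a : F, ∑ b : F, ∑ c : F, if linAccept (q.2.1 q.1) q.2.2.1 q.2.2.2 a b c then
        (expVal S.ψ (S.A q.2.1 a) (S.A (Function.update q.2.1 q.1 q.2.2.1) b)
          (S.A (Function.update q.2.1 q.1 q.2.2.2) c)).re else 0 := by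
    intro q hq
    rw [linChoices, mem_filter] at hq
    rw [lineFail, if_pos hq.2, Function.update_eq_self, eq_sub_iff_add_eq]
    simp only [← sum_add_distrib]
    rw [← S.sum_re_expVal q.2.1 (Function.update q.2.1 q.1 q.2.2.1)
      (Function.update q.2.1 q.1 q.2.2.2)]
    refine sum_congr rfl fun a _ => sum_congr rfl fun b _ => sum_congr rfl fun c _ => ?_
    split_ifs <;> simp
  rw [sum_congr rfl h, sum_sub_distrib, sum_const, nsmul_eq_mul, mul_one, mul_sub, mul_one,
    linProb, card_mul_expect]

lemma linProb_le_one : S.linProb ≤ 1 := by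
  rcases (linChoices F n).eq_empty_or_nonempty with h | h
  · simp [linProb, h]
  · have h1 : (0 : ℝ) < #(linChoices F n) := by exact_mod_cast h.card_pos
    have h2 : 0 ≤ ∑ q ∈ linChoices F n, S.lineFail q.1 q.2.1 (q.2.1 q.1) q.2.2.1 q.2.2.2 :=
      sum_nonneg fun q _ => S.lineFail_nonneg _ _ _ _ _
    rw [sum_linChoices_lineFail] at h2
    nlinarith [nonneg_of_mul_nonneg_right h2 h1]

/-- The test picks its direction uniformly, so summing over directions costs the factor `n`.
Coincident points contribute nothing on the left and are never chosen by the referee. -/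
lemma sum_expect_lineFail_le {ε : ℝ} (hwin : 1 - ε ≤ S.linProb) :
    ∑ i, 𝔼 x, 𝔼 t, 𝔼 t', 𝔼 t'', S.lineFail i x t t' t'' ≤ n * ε := by
  classical
  set f : Fin n → (Fin n → F) → F → F → ℝ := fun i x t' t'' => S.lineFail i x (x i) t' t'' with hf
  -- `lineFail` ignores `x i`, so `t` may be identified with the random coordinate `x i`.
  have h1 : ∀ i, 𝔼 x, 𝔼 t, 𝔼 t', 𝔼 t'', S.lineFail i x t t' t'' =
      𝔼 x, 𝔼 t', 𝔼 t'', f i x t' t'' := by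
    intro i
    rw [← expect_resample i fun x => 𝔼 t', 𝔼 t'', f i x t' t'']
    simp only [hf, lineFail_update, Function.update_self]
  have h2 : ∑ i, ∑ x, ∑ t', ∑ t'', f i x t' t'' =
      ∑ q ∈ linChoices F n, f q.1 q.2.1 q.2.2.1 q.2.2.2 := by
    rw [linChoices, sum_filter_of_ne]
    · simp only [Fintype.sum_prod_type]
    · intro q _ hq
      by_contra hne
      exact hq (if_neg hne)
  have h3 : ∑ q ∈ linChoices F n, f q.1 q.2.1 q.2.2.1 q.2.2.2 ≤
      n * ((Fintype.card (Fin n → F) : ℝ) * Fintype.card F * Fintype.card F) * ε := by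
    rw [hf, S.sum_linChoices_lineFail]
    have hc : (#(linChoices F n) : ℝ) ≤
        n * ((Fintype.card (Fin n → F) : ℝ) * Fintype.card F * Fintype.card F) := by
      have := card_le_univ (linChoices F n)
      rw [Fintype.card_prod, Fintype.card_prod, Fintype.card_prod, Fintype.card_fin] at this
      rw [mul_assoc (Fintype.card (Fin n → F) : ℝ)]
      exact_mod_cast this
    gcongr
    · linarith [S.linProb_le_one]
    · linarith
  have hp : (0 : ℝ) < (Fintype.card (Fin n → F) : ℝ) * Fintype.card F * Fintype.card F := by
    have : 0 < Fintype.card (Fin n → F) * Fintype.card F * Fintype.card F :=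
      Nat.mul_pos (Nat.mul_pos Fintype.card_pos Fintype.card_pos) Fintype.card_pos
    exact_mod_cast this
  have h4 : ∑ i, 𝔼 x, 𝔼 t', 𝔼 t'', f i x t' t'' = (∑ i, ∑ x, ∑ t', ∑ t'', f i x t' t'') /
      ((Fintype.card (Fin n → F) : ℝ) * Fintype.card F * Fintype.card F) := by
    simp only [Fintype.expect_eq_sum_div_card, ← sum_div, div_div]
    ring_nf
  rw [sum_congr rfl fun i _ => h1 i, h4, h2, div_le_iff₀ hp]
  linarith

/-- The linearity test controls the operators of a sub-measurement whose outcomes assign affinely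
related values to three points of a line. -/
lemma sum_wn_line_le {G : Type*} [Fintype G] {R : G → Matrix d d ℂ} (hR : ∀ g, 0 ≤ R g)
    (hR1 : ∑ g, R g ≤ 1) (i : Fin n) (x : Fin n → F) (w : F → G → F)
    (hw : ∀ g, ∃ a b, ∀ t, w t g = a * t + b) (t t' t'' : F) (h1 : t ≠ t') (h2 : t' ≠ t'')
    (h3 : t ≠ t'') :
    ∑ g, wn S.ψ (reg1 (R g)) (reg3 (S.A (Function.update x i t'') (w t'' g)) *
      reg2 (1 - S.A (Function.update x i t') (w t' g)) *
      reg1 (S.A (Function.update x i t) (w t g))) ≤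
      S.lineFail i x t t' t'' := by
  classical
  set P := S.A (Function.update x i t)
  set P' := S.A (Function.update x i t')
  set Q := S.A (Function.update x i t'')
  have hd : t'' - t ≠ 0 := sub_ne_zero.2 h3.symm
  have hd' : t' - t ≠ 0 := sub_ne_zero.2 h1.symm
  -- The value at `t'` of the affine function with values `q.1` at `t` and `q.2` at `t''`. The
  -- operators thus depend on `g` only through its two end values, so `sum_wn_fiber_le` applies.
  let mid : F × F → F := fun q => q.1 + (q.2 - q.1) / (t'' - t) * (t' - t)
  let X : F × F → Matrix (d × d × d) (d × d × d) ℂ := fun q =>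
    reg3 (Q q.2) * reg2 (1 - P' (mid q)) * reg1 (P q.1)
  have hmid : ∀ g, w t' g = mid (w t g, w t'' g) := by
    intro g
    obtain ⟨a, b, hab⟩ := hw g
    simp only [mid, hab]
    field_simp
    ring
  have hX : ∀ g, reg3 (Q (w t'' g)) * reg2 (1 - P' (w t' g)) * reg1 (P (w t g)) =
      X (w t g, w t'' g) := fun g => by
    simp only [X, ← hmid]
  have hsum : ∑ g, reg1 (R g) ≤ (1 : Matrix (d × d × d) (d × d × d) ℂ) := by
    have := reg1_nonneg (sub_nonneg.2 hR1)
    rw [map_sub, map_one, map_sum] at this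
    exact sub_nonneg.1 this
  rw [sum_congr rfl fun g _ => congrArg _ (hX g)]
  refine (sum_wn_fiber_le S.ψ _ (fun g => reg1_nonneg (hR g)) hsum
    (fun g => (w t g, w t'' g)) X).trans ?_
  rw [lineFail, if_pos ⟨h1.symm, h3.symm, h2⟩, Fintype.sum_prod_type]
  refine sum_le_sum fun a _ => ?_
  rw [sum_comm]
  refine sum_le_sum fun c _ => ?_
  rw [wn_one_reg_product S.ψ (S.isStarProjection _ _) (S.isStarProjection _ _).one_sub
    (S.isStarProjection _ _)]
  have h4 : (1 : Matrix d d ℂ) - P' (mid (a, c)) = ∑ b with b ≠ mid (a, c), P' b := by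
    rw [← S.sum_eq_one (Function.update x i t'), sub_eq_iff_eq_add, filter_ne',
      sum_erase_add _ _ (mem_univ _)]
  have h5 : (expVal S.ψ (P a) (1 - P' (mid (a, c))) (Q c)).re =
      ∑ b with b ≠ mid (a, c), (expVal S.ψ (P a) (P' b) (Q c)).re := by
    simp only [re_expVal, h4, map_sum, mul_sum, sum_mul]
  rw [h5, sum_filter]
  refine sum_le_sum fun b _ => ?_
  have h6 := re_expVal_nonneg S.ψ (S.A_nonneg (Function.update x i t) a)
    (S.A_nonneg (Function.update x i t') b) (S.A_nonneg (Function.update x i t'') c)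
  split_ifs with hb hacc hacc
  -- Acceptance forces the middle answer to be the interpolated one.
  · refine absurd ?_ hb
    have h7 := hacc.1.trans hacc.2
    simp only [mid]
    rw [← h7]
    field_simp
    ring
  · exact le_rfl
  · exact le_rfl
  · exact h6

end Strategy

/-! ### Splitting points into head and tail. -/

section Coordinates

variable {F : Type u} {n k : ℕ}

lemma headPart_glue (hk : k ≤ n) (w : Fin k → F) (z : Tail F n k) :
    headPart hk (glue w z) = w := by
  funext j
  simp [headPart, glue]

lemma tailPart_glue (w : Fin k → F) (z : Tail F n k) : tailPart k (glue w z) = z := by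
  funext j
  simp [tailPart, glue, not_lt.2 j.2]

lemma glue_headPart_tailPart (hk : k ≤ n) (x : Fin n → F) :
    glue (headPart hk x) (tailPart k x) = x := by
  funext j
  by_cases h : (j : ℕ) < k <;> simp [headPart, tailPart, glue, h]

lemma glue_update (hk : k ≤ n) (w : Fin k → F) (z : Tail F n k) (i : Fin k) (t : F) :
    glue (Function.update w i t) z = Function.update (glue w z) (Fin.castLE hk i) t := by
  funext j
  by_cases hj : j = Fin.castLE hk i
  · subst hj
    simp [glue]
  · rw [Function.update_of_ne hj]
    by_cases h : (j : ℕ) < k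
    · have : (⟨j, h⟩ : Fin k) ≠ i := fun h' => hj (Fin.ext (by simp [← h']))
      simp [glue, h, this]
    · simp [glue, h]

/-- A point of `F^n` as a pair of a head and a tail. -/
def glueEquiv (hk : k ≤ n) : Tail F n k × (Fin k → F) ≃ (Fin n → F) where
  toFun q := glue q.2 q.1
  invFun x := (tailPart k x, headPart hk x)
  left_inv q := by simp [headPart_glue, tailPart_glue]
  right_inv x := glue_headPart_tailPart hk x

lemma expect_glue [Fintype F] (hk : k ≤ n) (f : (Fin n → F) → ℝ) :
    𝔼 x, f x = 𝔼 z : Tail F n k, 𝔼 w, f (glue w z) := by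
  rw [← expect_product', univ_product_univ]
  exact (Fintype.expect_equiv (glueEquiv hk) _ _ fun q => rfl).symm

end Coordinates

/-! ### Inconsistency with the measurements of the strategy. -/

section Restriction

variable {F : Type u} [Field F] [Fintype F] {d : Type v} [Fintype d] [DecidableEq d] {n k : ℕ}

omit [Field F] [Fintype F] in
lemma restrictAt_self (hk : k ≤ n) (g : (Fin k → F) → F) (x : Fin n → F) :
    restrictAt hk g x = g := by
  funext w
  simp [restrictAt]

omit [Fintype F] in
lemma restrictAt_zero_eq_iff (hk : k ≤ n) (g : (Fin k → F) → F) (x : Fin n → F) (f : ML F 0) :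
    restrictAt hk g x = f.1 ↔ constEquiv F f = g (headPart hk x) := by
  have h : restrictAt hk g x = fun _ : Fin 0 → F => g (headPart hk x) := by
    funext w
    simp only [restrictAt, Nat.not_lt_zero, dif_neg, not_false_eq_true]
    rfl
  rw [h]
  constructor
  · intro h'
    exact (congrFun h' Fin.elim0).symm
  · intro h'
    funext w
    rw [← h']
    exact congrArg f.1 (Subsingleton.elim _ _)

omit [Field F] [Fintype F] in
lemma glue_elim0_tailPart (x : Fin n → F) : glue Fin.elim0 (tailPart 0 x) = x := by
  funext j
  simp [glue, tailPart]

namespace Strategy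

variable (S : Strategy F d n)

omit [Field F] in
-- The state is invariant under the exchange of the first two registers.
lemma trRho_comm (X Y : Matrix d d ℂ) : trRho S.ψ X Y = trRho S.ψ Y X := by
  let e : d × d × d ≃ d × d × d :=
    { toFun := fun q => (q.2.1, q.1, q.2.2)
      invFun := fun q => (q.2.1, q.1, q.2.2)
      left_inv := fun q => rfl
      right_inv := fun q => rfl }
  have hψ : S.ψ ∘ e = S.ψ := by
    funext q
    have := S.perm_invariant (Equiv.swap 0 1) ![q.1, q.2.1, q.2.2]
    simpa [e, Equiv.swap_apply_def] using this
  have hM : (X ⊗ₖ (Y ⊗ₖ (1 : Matrix d d ℂ))).submatrix e e = Y ⊗ₖ (X ⊗ₖ 1) := by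
    ext a b
    simp [e, Matrix.kroneckerMap_apply]
    ring
  have h : star S.ψ ⬝ᵥ ((X ⊗ₖ (Y ⊗ₖ (1 : Matrix d d ℂ))) *ᵥ S.ψ) =
      star S.ψ ⬝ᵥ ((Y ⊗ₖ (X ⊗ₖ (1 : Matrix d d ℂ))) *ᵥ S.ψ) := by
    rw [← hM]
    conv_rhs => rw [← hψ]
    rw [Matrix.submatrix_mulVec_equiv]
    rw [show star (S.ψ ∘ e) = star S.ψ ∘ e from rfl]
    rw [Function.comp_assoc, Equiv.self_comp_symm, Function.comp_id,
      comp_equiv_dotProduct_comp_equiv]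
  unfold trRho expVal
  rw [h]

lemma incLE_comm (P Q : SubFamily F d n k) : incLE S.ψ P Q = incLE S.ψ Q P := by
  classical
  unfold incLE
  simp only [restrictAt_self]
  refine expect_congr rfl fun x _ => ?_
  rw [sum_comm]
  refine sum_congr rfl fun g _ => sum_congr rfl fun f _ => ?_
  rw [S.trRho_comm]
  simp only [ne_comm]

/-- The measurement operator which a function of the first coordinates selects at a point. -/
def sel (w : Fin k → F) (z : Tail F n k) (g : ML F k) : Matrix d d ℂ := S.A (glue w z) (g.1 w)

/-- The average over the first coordinates of the operators selected by a function. -/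
noncomputable def selAvg (z : Tail F n k) (g : ML F k) : Matrix d d ℂ := 𝔼 w, S.sel w z g

lemma sel_isStarProjection (w : Fin k → F) (z : Tail F n k) (g : ML F k) :
    IsStarProjection (S.sel w z g) := S.isStarProjection _ _

/-- The answers other than `g(w)` have operators adding up to `1 - sel w z g`. Symmetry of the state
puts `R` on the first register. -/
lemma inc_toFamily (R : SubFamily F d n k) :
    inc S.ψ R S.toFamily =
      𝔼 z, 𝔼 w, ∑ g, ev S.ψ (reg1 (R.op z g) * reg2 (1 - S.sel w z g)) := by
  classical
  have h1 : inc S.ψ R S.toFamily = incLE S.ψ S.toFamily R := by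
    rw [inc]
    split_ifs with h
    -- For arity `0` the definition of `inc` takes its arguments in the opposite order.
    · obtain rfl : k = 0 := Nat.le_zero.1 h
      exact S.incLE_comm _ _
    · rfl
  rw [h1, incLE, expect_glue R.arity_le]
  refine expect_congr rfl fun z _ => expect_congr rfl fun w _ => ?_
  rw [sum_comm]
  refine sum_congr rfl fun g _ => ?_
  simp only [ne_eq, restrictAt_zero_eq_iff, headPart_glue, tailPart_glue, toFamily,
    glue_elim0_tailPart]
  rw [Equiv.sum_comp (constEquiv F) fun a => if ¬ a = g.1 w then
    trRho S.ψ (S.A (glue w z) a) (R.op z g) else 0, ← sum_filter, filter_ne']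
  simp only [S.trRho_comm _ (R.op z g), trRho_eq_ev]
  have h2 : 1 - S.sel w z g = ∑ a ∈ univ.erase (g.1 w), S.A (glue w z) a := by
    rw [← S.sum_eq_one (glue w z), sub_eq_iff_eq_add, sel, sum_erase_add _ _ (mem_univ _)]
  rw [h2, map_sum, mul_sum, map_sum]

end Strategy

end Restriction

namespace SubFamily

variable {F : Type u} [Field F] [Fintype F] {d : Type v} [Fintype d] [DecidableEq d] {n k : ℕ}
  (R : SubFamily F d n k)

lemma op_nonneg (z : Tail F n k) (g : ML F k) : 0 ≤ R.op z g :=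
  Matrix.nonneg_iff_posSemidef.2 (R.posSemidef z g)

lemma sum_reg1_le_one (z : Tail F n k) :
    ∑ g, reg1 (R.op z g) ≤ (1 : Matrix (d × d × d) (d × d × d) ℂ) := by
  have := reg1_nonneg (sub_nonneg.2 (R.sum_le_one z))
  rw [map_sub, map_one, map_sum] at this
  exact sub_nonneg.1 this

end SubFamily

/-! ### The spread of the selected operators. -/

namespace Strategy

variable {F : Type u} [Field F] [Fintype F] {d : Type v} [Fintype d] [DecidableEq d] {n k : ℕ}
  (S : Strategy F d n) (R : SubFamily F d n k)

lemma sum_wn_op_one_le (z : Tail F n k) : ∑ g, wn S.ψ (reg1 (R.op z g)) 1 ≤ 1 := by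
  rw [← wn_sum, wn, star_one, one_mul, mul_one, ← S.ev_one]
  exact ev_mono S.ψ (R.sum_reg1_le_one z)

lemma sum_wn_op_reg1_sub_reg2_le (w : Fin k → F) (z : Tail F n k) :
    ∑ g, wn S.ψ (reg1 (R.op z g)) (reg1 (S.sel w z g) - reg2 (S.sel w z g)) ≤
      S.defect (glue w z) := by
  classical
  exact (sum_wn_fiber_le S.ψ _ (fun g => reg1_nonneg (R.op_nonneg z g)) (R.sum_reg1_le_one z)
    (fun g => g.1 w) fun a => reg1 (S.A (glue w z) a) - reg2 (S.A (glue w z) a)).trans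
      (S.sum_wn_reg1_sub_reg2_le _)

lemma sum_wn_op_reg2_sub_reg3_le (w : Fin k → F) (z : Tail F n k) :
    ∑ g, wn S.ψ (reg1 (R.op z g)) (reg2 (S.sel w z g) - reg3 (S.sel w z g)) ≤
      S.defect (glue w z) := by
  classical
  exact (sum_wn_fiber_le S.ψ _ (fun g => reg1_nonneg (R.op_nonneg z g)) (R.sum_reg1_le_one z)
    (fun g => g.1 w) fun a => reg2 (S.A (glue w z) a) - reg3 (S.A (glue w z) a)).trans
      (S.sum_wn_reg2_sub_reg3_le _)

/-- The spread in one direction, on the line through `glue w z`. -/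
lemma line_spread_at_le {c s : ℝ} (hc : 0 < c) (hs : 0 < s)
    (hsF : 4 / (Fintype.card F : ℝ) ≤ s) (i : Fin k) (w : Fin k → F) (z : Tail F n k) :
    𝔼 t, 𝔼 t', ∑ g, wn S.ψ (reg1 (R.op z g)) (reg2 (S.sel (Function.update w i t) z g) -
        reg2 (S.sel (Function.update w i t') z g)) ≤
      4 * s * 𝔼 t, ∑ g, ev S.ψ (reg1 (R.op z g) *
        reg2 (1 - S.sel (Function.update w i t) z g)) +
      4 / s * (c + 1 / (2 * c) * (3 * 𝔼 t, S.defect (glue (Function.update w i t) z) +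
        2 * 𝔼 t, 𝔼 t', 𝔼 t'', S.lineFail (Fin.castLE R.arity_le i) (glue w z) t t' t'')) := by
  classical
  refine line_spread_le S.ψ (R.op_nonneg z) (p := fun t g => S.sel (Function.update w i t) z g)
    (fun t g => S.sel_isStarProjection _ _ _) hc hs hsF _ _ (S.sum_wn_op_one_le R z)
    (fun t => S.defect_nonneg _) (fun t t' t'' => S.lineFail_nonneg _ _ _ _ _)
    (fun t => S.sum_wn_op_reg2_sub_reg3_le R _ z) (fun t => S.sum_wn_op_reg1_sub_reg2_le R _ z)
    fun t t' t'' h1 h2 h3 => ?_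
  have := S.sum_wn_line_le (R.op_nonneg z) (R.sum_le_one z) (Fin.castLE R.arity_le i) (glue w z)
    (fun t g => g.1 (Function.update w i t)) (fun g => g.2 i w) t t' t'' h1 h2 h3
  simpa only [sel, glue_update R.arity_le] using this

lemma spread_reg2_le {c s : ℝ} (hc : 0 < c) (hs : 0 < s)
    (hsF : 4 / (Fintype.card F : ℝ) ≤ s) :
    𝔼 z, 𝔼 w, ∑ g, wn S.ψ (reg1 (R.op z g)) (reg2 (S.sel w z g) - reg2 (S.selAvg z g)) ≤
      k * (2 * s * inc S.ψ R S.toFamily + 2 / s * (c + 1 / (2 * c) * (3 * 𝔼 x, S.defect x))) +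
      2 / (s * c) * ∑ i, 𝔼 x, 𝔼 t, 𝔼 t', 𝔼 t'', S.lineFail i x t t' t'' := by
  classical
  set E : ℝ := 4 * s * inc S.ψ R S.toFamily +
    4 / s * (c + 1 / (2 * c) * (3 * 𝔼 x, S.defect x)) with hE
  set Λ : Fin n → ℝ := fun i => 𝔼 x, 𝔼 t, 𝔼 t', 𝔼 t'', S.lineFail i x t t' t'' with hΛ
  have hΛ0 : ∀ i, 0 ≤ Λ i := fun i => expect_nonneg fun x _ => expect_nonneg fun t _ =>
    expect_nonneg fun t' _ => expect_nonneg fun t'' _ => S.lineFail_nonneg _ _ _ _ _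
  have hdir : ∀ i : Fin k, 𝔼 z, 𝔼 w, 𝔼 t, 𝔼 t', ∑ g, wn S.ψ (reg1 (R.op z g))
      (reg2 (S.sel (Function.update w i t) z g) - reg2 (S.sel (Function.update w i t') z g)) ≤
      E + 4 / (s * c) * Λ (Fin.castLE R.arity_le i) := by
    intro i
    refine (expect_le_expect fun z _ => expect_le_expect fun w _ =>
      S.line_spread_at_le R hc hs hsF i w z).trans (le_of_eq ?_)
    have h1 : ∀ z : Tail F n k, 𝔼 w, 𝔼 t, ∑ g, ev S.ψ (reg1 (R.op z g) *
        reg2 (1 - S.sel (Function.update w i t) z g)) =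
        𝔼 w, ∑ g, ev S.ψ (reg1 (R.op z g) * reg2 (1 - S.sel w z g)) := fun z =>
      expect_resample i fun w => ∑ g, ev S.ψ (reg1 (R.op z g) * reg2 (1 - S.sel w z g))
    have h2 : ∀ z : Tail F n k, 𝔼 w, 𝔼 t, S.defect (glue (Function.update w i t) z) =
        𝔼 w, S.defect (glue w z) := fun z => expect_resample i fun w => S.defect (glue w z)
    have h3 := expect_glue R.arity_le S.defect
    have h4 := expect_glue R.arity_le fun x =>
      𝔼 t, 𝔼 t', 𝔼 t'', S.lineFail (Fin.castLE R.arity_le i) x t t' t''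
    simp only [expect_add_distrib, ← mul_expect, Fintype.expect_const, h1, h2, ← h3, ← h4,
      ← S.inc_toFamily R]
    rw [hE]
    field_simp
    ring
  have hvar : 𝔼 z, 𝔼 w, ∑ g, wn S.ψ (reg1 (R.op z g))
      (reg2 (S.sel w z g) - reg2 (S.selAvg z g)) ≤ ∑ i : Fin k, 1 / 2 * 𝔼 z, 𝔼 w, 𝔼 t, 𝔼 t', ∑ g,
      wn S.ψ (reg1 (R.op z g))
      (reg2 (S.sel (Function.update w i t) z g) - reg2 (S.sel (Function.update w i t') z g)) := by
    have h5 : ∀ (z : Tail F n k) (g : ML F k),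
        𝔼 w, wn S.ψ (reg1 (R.op z g)) (reg2 (S.sel w z g) - reg2 (S.selAvg z g)) ≤
        ∑ i, 1 / 2 * 𝔼 w, 𝔼 t, 𝔼 t', wn S.ψ (reg1 (R.op z g))
          (reg2 (S.sel (Function.update w i t) z g) -
            reg2 (S.sel (Function.update w i t') z g)) := by
      intro z g
      have h6 := wn_variance_le_dirichlet S.ψ (reg1_nonneg (R.op_nonneg z g)) k
        fun w => reg2 (S.sel w z g)
      rw [← map_expect_of_additive] at h6
      refine h6.trans (le_of_eq (sum_congr rfl fun i _ => ?_))
      -- Resampling the starting coordinate too turns the Dirichlet form into a mean over two free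
      -- points `t`, `t'` of a line.
      rw [← expect_resample i fun w => 𝔼 t, wn S.ψ (reg1 (R.op z g))
        (reg2 (S.sel w z g) - reg2 (S.sel (Function.update w i t) z g))]
      simp only [Function.update_idem]
    calc _ = 𝔼 z, ∑ g, 𝔼 w, wn S.ψ (reg1 (R.op z g))
          (reg2 (S.sel w z g) - reg2 (S.selAvg z g)) := by simp only [expect_sum_comm]
      _ ≤ _ := expect_le_expect fun z _ => sum_le_sum fun g _ => h5 z g
      _ = _ := by
        simp only [expect_sum_comm, mul_sum, ← mul_expect]
        rw [sum_comm]
  refine hvar.trans ?_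
  calc _ ≤ ∑ i : Fin k, 1 / 2 * (E + 4 / (s * c) * Λ (Fin.castLE R.arity_le i)) :=
        sum_le_sum fun i _ => mul_le_mul_of_nonneg_left (hdir i) (by norm_num)
    _ = k * (E / 2) + 2 / (s * c) * ∑ i : Fin k, Λ (Fin.castLE R.arity_le i) := by
        simp only [mul_add, sum_add_distrib, sum_const, card_univ, Fintype.card_fin, nsmul_eq_mul,
          mul_sum]
        congr 1
        · ring
        · exact sum_congr rfl fun i _ => by ring
    _ ≤ k * (E / 2) + 2 / (s * c) * ∑ i, Λ i := by
        have h7 : ∑ i : Fin k, Λ (Fin.castLE R.arity_le i) ≤ ∑ i, Λ i := by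
          rw [← sum_image (s := univ) (g := Fin.castLE R.arity_le) fun a _ b _ h =>
            Fin.castLE_injective R.arity_le h]
          exact sum_le_univ_sum_of_nonneg hΛ0
        gcongr
    _ = _ := by
        rw [hE]
        ring

/-- The spread of the selected operators around their average. -/
noncomputable def spread : ℝ :=
  𝔼 z, 𝔼 w, ∑ g, wn S.ψ (reg1 (R.op z g)) (reg1 (S.sel w z g) - reg1 (S.selAvg z g))

lemma expect_wn_reg1_sub_reg2_le :
    𝔼 z, 𝔼 w, ∑ g, wn S.ψ (reg1 (R.op z g)) (reg1 (S.sel w z g) - reg2 (S.sel w z g)) ≤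
      𝔼 x, S.defect x := by
  rw [expect_glue R.arity_le]
  exact expect_le_expect fun z _ => expect_le_expect fun w _ => S.sum_wn_op_reg1_sub_reg2_le R w z

/-- Convexity: a difference of averages is no larger in mean square than the differences averaged.
-/
lemma expect_wn_selAvg_le :
    𝔼 z, ∑ g, wn S.ψ (reg1 (R.op z g)) (reg1 (S.selAvg z g) - reg2 (S.selAvg z g)) ≤
      𝔼 x, S.defect x := by
  refine le_trans (expect_le_expect fun z _ => ?_) (S.expect_wn_reg1_sub_reg2_le R)
  rw [expect_sum_comm]
  refine sum_le_sum fun g _ => ?_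
  rw [selAvg, map_expect_of_additive, map_expect_of_additive, ← expect_sub_distrib]
  exact wn_expect_le S.ψ (reg1_nonneg (R.op_nonneg z g)) _

/-- The variance estimate needs operators that commute with the weight, so it is made on the second
register. The consistency test carries both the selected operator and its average back to the first.
-/
lemma spread_le : S.spread R ≤ 6 * 𝔼 x, S.defect x +
    4 * 𝔼 z, 𝔼 w, ∑ g, wn S.ψ (reg1 (R.op z g))
      (reg2 (S.sel w z g) - reg2 (S.selAvg z g)) := by
  have h1 := S.expect_wn_reg1_sub_reg2_le R
  have h2 := S.expect_wn_selAvg_le R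
  have h3 : S.spread R ≤ 𝔼 z, 𝔼 w,
      (2 * ∑ g, wn S.ψ (reg1 (R.op z g)) (reg1 (S.sel w z g) - reg2 (S.sel w z g)) +
      (4 * ∑ g, wn S.ψ (reg1 (R.op z g)) (reg2 (S.sel w z g) - reg2 (S.selAvg z g)) +
      4 * ∑ g, wn S.ψ (reg1 (R.op z g)) (reg1 (S.selAvg z g) - reg2 (S.selAvg z g)))) := by
    refine expect_le_expect fun z _ => expect_le_expect fun w _ => ?_
    simp only [mul_sum, ← sum_add_distrib]
    refine sum_le_sum fun g _ => ?_
    have hW := reg1_nonneg (R.op_nonneg z g)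
    have e : reg1 (S.sel w z g) - reg1 (S.selAvg z g) =
        (reg1 (S.sel w z g) - reg2 (S.sel w z g)) +
        ((reg2 (S.sel w z g) - reg2 (S.selAvg z g)) +
        (reg2 (S.selAvg z g) - reg1 (S.selAvg z g))) := by abel
    have h4 := wn_add_le S.ψ hW (reg1 (S.sel w z g) - reg2 (S.sel w z g))
      ((reg2 (S.sel w z g) - reg2 (S.selAvg z g)) + (reg2 (S.selAvg z g) - reg1 (S.selAvg z g)))
    have h5 := wn_add_le S.ψ hW (reg2 (S.sel w z g) - reg2 (S.selAvg z g))
      (reg2 (S.selAvg z g) - reg1 (S.selAvg z g))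
    rw [wn_sub_comm S.ψ (reg2 (S.selAvg z g))] at h5
    rw [e]
    linarith
  simp only [expect_add_distrib, ← mul_expect, Fintype.expect_const] at h3
  linarith

end Strategy

/-! ### Polar decomposition. -/

section Polar

variable {d : Type v} [Fintype d] [DecidableEq d]

/-- A weak polar decomposition: the positive part of `M` is `M U` for a partial isometry `U`. -/
lemma exists_mul_eq_sqrt (M : Matrix d d ℂ) :
    ∃ U : Matrix d d ℂ, U * star U ≤ 1 ∧ M * U = CFC.sqrt (M * star M) := by
  set H := M * star M with hH
  have hH0 : 0 ≤ H := mul_star_self_nonneg M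
  have hsa : IsSelfAdjoint H := .of_nonneg hH0
  have hcont : ∀ f : ℝ → ℝ, ContinuousOn f (spectrum ℝ H) := fun f =>
    (Matrix.finite_real_spectrum (A := H)).continuousOn f
  have hspec : ∀ x ∈ spectrum ℝ H, 0 ≤ x := fun x hx => spectrum_nonneg_of_nonneg hH0 hx
  -- Since `0⁻¹ = 0`, `K` is the pseudo-inverse of `√H`, and no invertibility is needed.
  set f : ℝ → ℝ := fun x => (√x)⁻¹ with hf
  set K := cfc f H with hK
  have hKs : star K = K := (cfc_predicate f H : IsSelfAdjoint K).star_eq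
  have hHK : H * K = cfc (fun x => x * f x) H := by
    rw [cfc_mul (fun x => x) f H (hcont _) (hcont _), cfc_id' ℝ H]
  have hKK : K * K = cfc (fun x => f x * f x) H := by
    rw [cfc_mul f f H (hcont _) (hcont _)]
  refine ⟨star M * K, ?_, ?_⟩
  · have hp : IsStarProjection (star M * K * star (star M * K)) := by
      have h1 : K * K * H * (K * K) = K * K := by
        have h2 : K * K * H = cfc (fun x => f x * f x * x) H := by
          rw [cfc_mul (fun x => f x * f x) (fun x => x) H (hcont _) (hcont _), cfc_id' ℝ H, hKK]
        rw [h2, hKK, ← cfc_mul _ _ H (hcont _) (hcont _)]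
        refine cfc_congr fun x hx => ?_
        rcases (hspec x hx).eq_or_lt with h | h
        · simp [hf, ← h]
        · have h3 : √x ≠ 0 := (Real.sqrt_pos.2 h).ne'
          have h4 : x = √x * √x := (Real.mul_self_sqrt h.le).symm
          simp only [hf]
          nth_rewrite 3 [h4]
          field_simp
      have h5 : star M * K * star (star M * K) = star M * (K * K) * M := by
        rw [star_mul, star_star, hKs]
        simp only [mul_assoc]
      rw [h5]
      refine ⟨?_, ?_⟩
      · change star M * (K * K) * M * (star M * (K * K) * M) = _
        calc _ = star M * (K * K * H * (K * K)) * M := by simp only [hH, mul_assoc]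
          _ = _ := by rw [h1]
      · rw [IsSelfAdjoint]
        simp only [star_mul, star_star, hKs, mul_assoc]
    exact sub_nonneg.1 hp.one_sub.nonneg
  · rw [← mul_assoc, ← hH]
    refine (CFC.sqrt_unique ?_ ?_).symm
    · rw [hHK, ← cfc_mul _ _ H (hcont _) (hcont _)]
      nth_rewrite 2 [← cfc_id' ℝ H]
      refine cfc_congr fun x hx => ?_
      rcases (hspec x hx).eq_or_lt with h | h
      · simp [← h]
      · have h3 : √x ≠ 0 := (Real.sqrt_pos.2 h).ne'
        have h4 : x = √x * √x := (Real.mul_self_sqrt h.le).symm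
        simp only [hf]
        field_simp
        nlinarith
    · rw [hHK]
      exact cfc_nonneg fun x hx => mul_nonneg (hspec x hx) (by positivity)

end Polar

/-! ### The improved family and its properties. -/

namespace Strategy

variable {F : Type u} [Field F] [Fintype F] {d : Type v} [Fintype d] [DecidableEq d] {n k : ℕ}
  (S : Strategy F d n) (R : SubFamily F d n k)

lemma star_selAvg (z : Tail F n k) (g : ML F k) : star (S.selAvg z g) = S.selAvg z g := by
  have := map_expect_of_additive (starAddEquiv (R := Matrix d d ℂ)) univ fun w => S.sel w z g
  simp only [starAddEquiv_apply, (S.sel_isStarProjection _ z g).isSelfAdjoint.star_eq] at this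
  exact this

lemma sum_selected_conj_le (z : Tail F n k) (w : Fin k → F) (Q : ML F k → Matrix d d ℂ)
    (hQ : ∀ g, 0 ≤ Q g) (hQ1 : ∑ g, Q g ≤ 1) (a : F) [DecidableEq F] :
    ∑ g : ML F k with g.1 w = a, S.sel w z g * Q g * S.sel w z g ≤ S.A (glue w z) a := by
  have hA := S.isStarProjection (glue w z) a
  calc ∑ g : ML F k with g.1 w = a, S.sel w z g * Q g * S.sel w z g
      = S.A (glue w z) a * (∑ g : ML F k with g.1 w = a, Q g) * S.A (glue w z) a := by
        rw [mul_sum, sum_mul]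
        refine sum_congr rfl fun g hg => ?_
        rw [sel, (mem_filter.1 hg).2]
    _ ≤ S.A (glue w z) a * 1 * S.A (glue w z) a :=
        IsSelfAdjoint.conjugate_le_conjugate
          ((sum_le_univ_sum_of_nonneg hQ).trans hQ1) hA.isSelfAdjoint
    _ = S.A (glue w z) a := by rw [mul_one, hA.isIdempotentElem.eq]

/-- The map `X ↦ X R X` is operator convex on self-adjoint `X`, so `B R B` is at most the average of
the `p_w R p_w`. For fixed `w` these sum over `g` to at most `∑ a, A_x^a = 1`. -/
lemma sum_selAvg_conj_le (z : Tail F n k) :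
    ∑ g, S.selAvg z g * R.op z g * S.selAvg z g ≤ 1 := by
  classical
  have h1 : ∀ g, 𝔼 w, (S.sel w z g - S.selAvg z g) * R.op z g * (S.sel w z g - S.selAvg z g) =
      𝔼 w, S.sel w z g * R.op z g * S.sel w z g - S.selAvg z g * R.op z g * S.selAvg z g := by
    intro g
    simp only [sub_mul, mul_sub, expect_sub_distrib, ← mul_expect, ← expect_mul,
      Fintype.expect_const]
    rw [← selAvg]
    abel
  have h2 : ∀ g, S.selAvg z g * R.op z g * S.selAvg z g ≤
      𝔼 w, S.sel w z g * R.op z g * S.sel w z g := fun g => by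
    rw [← sub_nonneg, ← h1]
    refine expect_matrix_nonneg fun w => IsSelfAdjoint.conjugate_nonneg (R.op_nonneg z g) ?_
    rw [IsSelfAdjoint, star_sub, star_selAvg, (S.sel_isStarProjection w z g).isSelfAdjoint.star_eq]
  refine (sum_le_sum fun g _ => h2 g).trans ?_
  rw [← expect_sum_comm, ← sub_nonneg]
  have h3 : (1 : Matrix d d ℂ) - 𝔼 w, ∑ g, S.sel w z g * R.op z g * S.sel w z g =
      𝔼 w, (1 - ∑ g, S.sel w z g * R.op z g * S.sel w z g) := by
    rw [expect_sub_distrib, Fintype.expect_const]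
  rw [h3]
  refine expect_matrix_nonneg fun w => sub_nonneg.2 ?_
  rw [← sum_fiberwise univ (fun g : ML F k => g.1 w), ← S.sum_eq_one (glue w z)]
  exact sum_le_sum fun a _ => S.sum_selected_conj_le z w _ (R.op_nonneg z) (R.sum_le_one z) a

/-- The improved family: the operators of `R`, conjugated by the averages of the operators of the
strategy which they select. -/
noncomputable def improve : SubFamily F d n k where
  op z g := S.selAvg z g * R.op z g * S.selAvg z g
  arity_le := R.arity_le
  posSemidef z g := Matrix.nonneg_iff_posSemidef.1
    (IsSelfAdjoint.conjugate_nonneg (R.op_nonneg z g) (S.star_selAvg z g))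
  sum_le_one z := S.sum_selAvg_conj_le R z

/-- Take `Y = √R U` with `U` from the polar decomposition of `B √R`. The exact square root of `T` is
needed because the averages of the `Ŝ` are compared with `√T`, and `B √R` itself need not be
positive. -/
lemma exists_root_factors :
    ∃ Y : Tail F n k → ML F k → Matrix d d ℂ, (∀ z g, Y z g * star (Y z g) ≤ R.op z g) ∧
      ∀ z g, S.selAvg z g * Y z g = CFC.sqrt ((S.improve R).op z g) := by
  have h : ∀ z g, ∃ Y : Matrix d d ℂ, Y * star Y ≤ R.op z g ∧
      S.selAvg z g * Y = CFC.sqrt ((S.improve R).op z g) := by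
    intro z g
    have h0 := R.op_nonneg z g
    have hs : star (CFC.sqrt (R.op z g)) = CFC.sqrt (R.op z g) :=
      (IsSelfAdjoint.of_nonneg (CFC.sqrt_nonneg _)).star_eq
    obtain ⟨U, hU, hMU⟩ := exists_mul_eq_sqrt (S.selAvg z g * CFC.sqrt (R.op z g))
    refine ⟨CFC.sqrt (R.op z g) * U, ?_, ?_⟩
    · have h1 := star_right_conjugate_le_conjugate hU (CFC.sqrt (R.op z g))
      rw [mul_one, hs, CFC.sqrt_mul_sqrt_self _ h0] at h1
      rw [star_mul, hs]
      simpa only [mul_assoc] using h1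
    · rw [← mul_assoc, hMU, star_mul, hs, star_selAvg]
      congr 1
      rw [mul_assoc, ← mul_assoc (CFC.sqrt _), CFC.sqrt_mul_sqrt_self _ h0, ← mul_assoc]
      rfl
  choose Y hY using h
  exact ⟨Y, fun z g => (hY z g).1, fun z g => (hY z g).2⟩

/-- Conjugation by `B` turns the inconsistency into the squared length of `(1 - p) B ψ` weighted by
`R`, with `1 - p` on the second register and `B` on the first. Since `(1 - p) p = 0`, `B` may be
replaced by its distance from `p` on the second register. -/
lemma inc_improve_le :
    inc S.ψ (S.improve R) S.toFamily ≤ 2 * S.spread R + 2 * 𝔼 x, S.defect x := by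
  rw [inc_toFamily]
  have h1 : ∀ z w, ∑ g, ev S.ψ (reg1 ((S.improve R).op z g) * reg2 (1 - S.sel w z g)) ≤
      2 * ∑ g, wn S.ψ (reg1 (R.op z g)) (reg1 (S.sel w z g) - reg1 (S.selAvg z g)) +
      2 * ∑ g, wn S.ψ (reg1 (R.op z g)) (reg1 (S.sel w z g) - reg2 (S.sel w z g)) := by
    intro z w
    rw [mul_sum, mul_sum, ← sum_add_distrib]
    refine sum_le_sum fun g _ => ?_
    have hW := reg1_nonneg (R.op_nonneg z g)
    have hp := S.sel_isStarProjection w z g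
    have hC := hp.one_sub
    set p := S.sel w z g
    set B := S.selAvg z g with hB
    have e1 : ev S.ψ (reg1 ((S.improve R).op z g) * reg2 (1 - p)) =
        wn S.ψ (reg1 (R.op z g)) (reg2 (1 - p) * reg1 B) := by
      have : (S.improve R).op z g = B * R.op z g * B := rfl
      have c1 := commute_reg1_reg2 (R.op z g) (1 - p)
      have c2 := commute_reg1_reg2 B (1 - p)
      rw [wn, star_mul, ← map_star, ← map_star, hC.isSelfAdjoint.star_eq, hB, star_selAvg, ← hB,
        this, map_mul reg1, map_mul reg1]
      congr 1
      calc reg1 B * reg1 (R.op z g) * reg1 B * reg2 (1 - p)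
          = reg1 B * (reg1 (R.op z g) * (reg1 B * reg2 (1 - p * p))) := by
            rw [hp.isIdempotentElem.eq]
            simp only [mul_assoc]
        _ = reg1 B * (reg1 (R.op z g) * (reg2 (1 - p) * reg2 (1 - p) * reg1 B)) := by
            rw [hp.isIdempotentElem.eq, c2.eq, ← map_mul, hC.isIdempotentElem.eq]
        _ = reg1 B * ((reg1 (R.op z g) * reg2 (1 - p)) * (reg2 (1 - p) * reg1 B)) := by
            simp only [mul_assoc]
        _ = _ := by
            rw [c1.eq]
            simp only [mul_assoc]
    have e2 : reg2 (1 - p) * reg1 B =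
        reg2 (1 - p) * ((reg1 B - reg1 p) + (reg1 p - reg2 p)) := by
      have : reg2 (1 - p) * reg2 p = 0 := by
        rw [← map_mul, hp.isIdempotentElem.one_sub_mul_self, map_zero]
      rw [sub_add_sub_cancel, mul_sub, this, sub_zero]
    rw [e1, e2]
    refine (wn_projection_mul_le S.ψ hW (hC.map reg2).isSelfAdjoint
      (hC.map reg2).isIdempotentElem.eq (commute_reg1_reg2 _ _).symm _).trans ?_
    rw [wn_sub_comm S.ψ (reg1 p) (reg1 B)]
    exact wn_add_le S.ψ hW _ _
  refine (expect_le_expect fun z _ => expect_le_expect fun w _ => h1 z w).trans ?_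
  simp only [expect_add_distrib, ← mul_expect]
  have := S.expect_wn_reg1_sub_reg2_le R
  rw [← spread]
  linarith

/-- On the second register, `1 - B` is an average of projections `1 - p_w` whose weighted squared
lengths make up the inconsistency; the remainder moves `B` to the first. -/
lemma expect_wn_one_sub_selAvg_le :
    𝔼 z, ∑ g, wn S.ψ (reg1 (R.op z g)) (reg1 (1 - S.selAvg z g)) ≤
      2 * inc S.ψ R S.toFamily + 2 * 𝔼 x, S.defect x := by
  have h1 : ∀ z, ∑ g, wn S.ψ (reg1 (R.op z g)) (reg1 (1 - S.selAvg z g)) ≤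
      2 * 𝔼 w, ∑ g, ev S.ψ (reg1 (R.op z g) * reg2 (1 - S.sel w z g)) +
      2 * ∑ g, wn S.ψ (reg1 (R.op z g)) (reg1 (S.selAvg z g) - reg2 (S.selAvg z g)) := by
    intro z
    rw [expect_sum_comm, mul_sum, mul_sum, ← sum_add_distrib]
    refine sum_le_sum fun g _ => ?_
    have hW := reg1_nonneg (R.op_nonneg z g)
    have e1 : reg1 (1 - S.selAvg z g) = 𝔼 w, reg2 (1 - S.sel w z g) +
        (reg2 (S.selAvg z g) - reg1 (S.selAvg z g)) := by
      rw [← map_expect_of_additive reg2, expect_sub_distrib, Fintype.expect_const, ← selAvg,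
        map_sub, map_sub, map_one, map_one]
      abel
    have h2 := wn_expect_le S.ψ hW fun w => reg2 (1 - S.sel w z g)
    simp only [wn_reg1_reg2, (S.sel_isStarProjection _ z g).one_sub.isSelfAdjoint.star_eq,
      (S.sel_isStarProjection _ z g).one_sub.isIdempotentElem.eq] at h2
    have h3 := wn_add_le S.ψ hW (𝔼 w, reg2 (1 - S.sel w z g))
      (reg2 (S.selAvg z g) - reg1 (S.selAvg z g))
    rw [e1, wn_sub_comm S.ψ (reg1 (S.selAvg z g))]
    linarith
  refine (expect_le_expect fun z _ => h1 z).trans ?_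
  rw [expect_add_distrib, ← mul_expect, ← mul_expect, ← inc_toFamily]
  linarith [S.expect_wn_selAvg_le R]

/-- From `R - B R B = (1 - B) R + B R (1 - B)` and Cauchy-Schwarz for each pair of outcomes. The
absolute values inside the sum make the bound usable for every set of consistent pairs. -/
lemma sum_abs_ev_sub_le {c : ℝ} (hc : 0 < c) {G : Type*} [Fintype G] (P : G → Matrix d d ℂ)
    (hP : ∀ f, 0 ≤ P f) (hP1 : ∑ f, P f ≤ 1) (z : Tail F n k) :
    ∑ g, ∑ f, |ev S.ψ (reg1 (R.op z g) * reg2 (P f)) -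
        ev S.ψ (reg1 ((S.improve R).op z g) * reg2 (P f))| ≤
      c + 1 / c * ∑ g, wn S.ψ (reg1 (R.op z g)) (reg1 (1 - S.selAvg z g)) := by
  have hterm : ∀ g f, |ev S.ψ (reg1 (R.op z g) * reg2 (P f)) -
      ev S.ψ (reg1 ((S.improve R).op z g) * reg2 (P f))| ≤
      c / 2 * wn S.ψ (reg1 (R.op z g) * reg2 (P f)) 1 +
      (c / 2 * wn S.ψ (reg1 (R.op z g) * reg2 (P f)) (reg1 (S.selAvg z g)) +
      1 / c * wn S.ψ (reg1 (R.op z g) * reg2 (P f)) (reg1 (1 - S.selAvg z g))) := by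
    intro g f
    set B := S.selAvg z g with hB
    set r := R.op z g
    have hW := reg1_mul_reg2_nonneg (R.op_nonneg z g) (hP f)
    have e1 : ev S.ψ (reg1 r * reg2 (P f)) - ev S.ψ (reg1 ((S.improve R).op z g) * reg2 (P f)) =
        ev S.ψ (star (reg1 (1 - B)) * (reg1 r * reg2 (P f)) * 1) +
        ev S.ψ (star (reg1 B) * (reg1 r * reg2 (P f)) * reg1 (1 - B)) := by
      have h1 : (S.improve R).op z g = B * r * B := rfl
      rw [h1, ← map_star, ← map_star, star_sub, star_one, hB, star_selAvg, ← hB, ← map_sub,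
        ← map_add]
      congr 1
      have h2 : reg1 B * (reg1 r * reg2 (P f)) * reg1 (1 - B) =
          reg1 (B * r * (1 - B)) * reg2 (P f) := by
        simp only [map_mul, mul_assoc]
        rw [(commute_reg1_reg2 (1 - B) (P f)).eq]
      have h3 : reg1 (1 - B) * (reg1 r * reg2 (P f)) * 1 = reg1 ((1 - B) * r) * reg2 (P f) := by
        simp only [map_mul, mul_assoc, mul_one]
      rw [h2, h3, ← sub_mul, ← add_mul, ← map_sub, ← map_add]
      congr 2
      simp only [sub_mul, mul_sub, one_mul, mul_one]
      abel
    have h4 := abs_ev_cross_le S.ψ hW hc 1 (reg1 (1 - B))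
    rw [ev_cross_symm S.ψ hW] at h4
    have h5 := abs_ev_cross_le S.ψ hW hc (reg1 B) (reg1 (1 - B))
    have h6 : 1 / c = 1 / (2 * c) + 1 / (2 * c) := by
      field_simp
      norm_num
    rw [e1, h6, add_mul]
    have := abs_add_le (ev S.ψ (star (reg1 (1 - B)) * (reg1 r * reg2 (P f)) * 1))
      (ev S.ψ (star (reg1 B) * (reg1 r * reg2 (P f)) * reg1 (1 - B)))
    linarith
  have hsum : ∀ g X, ∑ f, wn S.ψ (reg1 (R.op z g) * reg2 (P f)) X ≤
      wn S.ψ (reg1 (R.op z g)) X := by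
    intro g X
    rw [← wn_sum, ← mul_sum, ← map_sum]
    refine wn_mono S.ψ ?_ X
    have := reg1_mul_reg2_nonneg (R.op_nonneg z g) (sub_nonneg.2 hP1)
    rw [map_sub, map_one, mul_sub, mul_one] at this
    exact sub_nonneg.1 this
  have hB1 : ∑ g, wn S.ψ (reg1 (R.op z g)) (reg1 (S.selAvg z g)) ≤ 1 := by
    have h1 : ∀ g, wn S.ψ (reg1 (R.op z g)) (reg1 (S.selAvg z g)) =
        ev S.ψ (reg1 ((S.improve R).op z g)) := fun g => by
      rw [wn, ← map_star, star_selAvg, ← map_mul, ← map_mul]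
      rfl
    rw [sum_congr rfl fun g _ => h1 g, ← map_sum, ← S.ev_one]
    exact ev_mono S.ψ ((S.improve R).sum_reg1_le_one z)
  calc _ ≤ ∑ g, (c / 2 * wn S.ψ (reg1 (R.op z g)) 1 +
      (c / 2 * wn S.ψ (reg1 (R.op z g)) (reg1 (S.selAvg z g)) +
      1 / c * wn S.ψ (reg1 (R.op z g)) (reg1 (1 - S.selAvg z g)))) := by
        refine sum_le_sum fun g _ => (sum_le_sum fun f _ => hterm g f).trans ?_
        simp only [sum_add_distrib, ← mul_sum]
        have hc2 : 0 ≤ c / 2 := by positivity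
        have hc3 : 0 ≤ 1 / c := by positivity
        gcongr <;> exact hsum g _
    _ ≤ _ := by
        simp only [sum_add_distrib, ← mul_sum]
        have h1 := mul_le_mul_of_nonneg_left (S.sum_wn_op_one_le R z) hc.le
        have h2 := mul_le_mul_of_nonneg_left hB1 hc.le
        linarith

/-- One formula for both orders of the arities, with a consistency predicate that does not depend on
`Q`, so that two families can be compared term by term. -/
lemma cons_eq {ℓ : ℕ} (P : SubFamily F d n ℓ) :
    ∃ good : (Fin n → F) → ML F k → ML F ℓ → Bool, ∀ Q : SubFamily F d n k,
      cons S.ψ P Q = 𝔼 x, ∑ g, ∑ f, if good x g f then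
        ev S.ψ (reg1 (Q.op (tailPart k x) g) * reg2 (P.op (tailPart ℓ x) f)) else 0 := by
  classical
  by_cases h : ℓ ≤ k
  · by_cases hk : k ≤ n
    · refine ⟨fun x g f => restrictAt hk g.1 x = f.1, fun Q => ?_⟩
      rw [cons, if_pos h, consLE]
      refine expect_congr rfl fun x _ => ?_
      rw [sum_comm]
      refine sum_congr rfl fun g _ => sum_congr rfl fun f _ => ?_
      rw [S.trRho_comm, trRho_eq_ev]
      simp
    · exact ⟨fun _ _ _ => false, fun Q => absurd Q.arity_le hk⟩
  · refine ⟨fun x g f => restrictAt P.arity_le f.1 x = g.1, fun Q => ?_⟩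
    rw [cons, if_neg h, consLE]
    refine expect_congr rfl fun x _ => sum_congr rfl fun g _ => sum_congr rfl fun f _ => ?_
    rw [trRho_eq_ev]
    simp

lemma abs_cons_sub_improve_le {c : ℝ} (hc : 0 < c) {ℓ : ℕ} (P : SubFamily F d n ℓ) :
    |cons S.ψ P R - cons S.ψ P (S.improve R)| ≤
      c + 1 / c * (2 * inc S.ψ R S.toFamily + 2 * 𝔼 x, S.defect x) := by
  obtain ⟨good, hgood⟩ := S.cons_eq (k := k) P
  have h1 : ∀ x, ∑ g, ∑ f, |ev S.ψ (reg1 (R.op (tailPart k x) g) * reg2 (P.op (tailPart ℓ x) f)) -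
      ev S.ψ (reg1 ((S.improve R).op (tailPart k x) g) * reg2 (P.op (tailPart ℓ x) f))| ≤
      c + 1 / c * ∑ g, wn S.ψ (reg1 (R.op (tailPart k x) g))
        (reg1 (1 - S.selAvg (tailPart k x) g)) := fun x =>
    S.sum_abs_ev_sub_le R hc _ (P.op_nonneg _) (P.sum_le_one _) _
  rw [hgood, hgood, ← expect_sub_distrib]
  have h2 := expect_glue R.arity_le fun x : Fin n → F => ∑ g, wn S.ψ (reg1 (R.op (tailPart k x) g))
        (reg1 (1 - S.selAvg (tailPart k x) g))
  simp only [tailPart_glue, Fintype.expect_const] at h2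
  calc _ ≤ 𝔼 x, (c + 1 / c * ∑ g, wn S.ψ (reg1 (R.op (tailPart k x) g))
        (reg1 (1 - S.selAvg (tailPart k x) g))) := by
        refine (abs_expect_le _ _).trans (expect_le_expect fun x _ => le_trans ?_ (h1 x))
        rw [← sum_sub_distrib]
        refine (abs_sum_le_sum_abs _ _).trans (sum_le_sum fun g _ => ?_)
        rw [← sum_sub_distrib]
        refine (abs_sum_le_sum_abs _ _).trans (sum_le_sum fun f _ => ?_)
        split_ifs
        · exact le_rfl
        · simp
    _ ≤ _ := by
        rw [expect_add_distrib, Fintype.expect_const, ← mul_expect, h2]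
        have hc3 : 0 ≤ 1 / c := by positivity
        gcongr
        exact S.expect_wn_one_sub_selAvg_le R

end Strategy

/-! ### The zero family and the numerical estimates. -/

namespace SubFamily

variable {F : Type u} [Field F] [Fintype F] {d : Type v} [Fintype d] [DecidableEq d] {n : ℕ}

/-- The family of zero operators. -/
def zero (F : Type u) [Field F] [Fintype F] (d : Type v) [Fintype d] [DecidableEq d] {n k : ℕ}
    (hk : k ≤ n) : SubFamily F d n k where
  op _ _ := 0
  arity_le := hk
  posSemidef _ _ := Matrix.PosSemidef.zero
  sum_le_one _ := by simp

end SubFamily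

namespace Strategy

variable {F : Type u} [Field F] [Fintype F] {d : Type v} [Fintype d] [DecidableEq d] {n k : ℕ}
  (S : Strategy F d n) (R : SubFamily F d n k)

lemma inc_zero (hk : k ≤ n) : inc S.ψ (SubFamily.zero F d hk) S.toFamily = 0 := by
  simp [inc_toFamily, SubFamily.zero]

lemma cons_zero (hk : k ≤ n) {ℓ : ℕ} (P : SubFamily F d n ℓ) :
    cons S.ψ P (SubFamily.zero F d hk) = 0 := by
  obtain ⟨good, hgood⟩ := S.cons_eq (k := k) P
  simp [hgood, SubFamily.zero]

lemma abs_cons_le_one {ℓ : ℕ} (P : SubFamily F d n ℓ) : |cons S.ψ P R| ≤ 1 := by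
  obtain ⟨good, hgood⟩ := S.cons_eq (k := k) P
  rw [hgood]
  have h0 : ∀ (x : Fin n → F) g f,
      0 ≤ ev S.ψ (reg1 (R.op (tailPart k x) g) * reg2 (P.op (tailPart ℓ x) f)) := fun x g f =>
    ev_nonneg S.ψ (reg1_mul_reg2_nonneg (R.op_nonneg _ g) (P.op_nonneg _ f))
  have h1 : ∀ x : Fin n → F,
      ∑ g, ∑ f, ev S.ψ (reg1 (R.op (tailPart k x) g) * reg2 (P.op (tailPart ℓ x) f)) ≤ 1 := by
    intro x
    simp only [← map_sum, ← mul_sum, ← sum_mul]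
    rw [← S.ev_one]
    refine ev_mono S.ψ ?_
    have h2 := reg1_mul_reg2_nonneg (sub_nonneg.2 (R.sum_le_one (tailPart k x)))
      (sum_nonneg fun f (_ : f ∈ univ) => P.op_nonneg (tailPart ℓ x) f)
    have h3 := reg2_nonneg (sub_nonneg.2 (P.sum_le_one (tailPart ℓ x)))
    rw [map_sub, map_one, sub_mul, one_mul] at h2
    rw [map_sub, map_one] at h3
    exact (sub_nonneg.1 h2).trans (sub_nonneg.1 h3)
  calc _ ≤ 𝔼 x : Fin n → F, (1 : ℝ) := by
        refine (abs_expect_le _ _).trans (expect_le_expect fun x _ => le_trans ?_ (h1 x))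
        refine (abs_sum_le_sum_abs _ _).trans (sum_le_sum fun g _ => ?_)
        refine (abs_sum_le_sum_abs _ _).trans (sum_le_sum fun f _ => ?_)
        split_ifs
        · exact (abs_of_nonneg (h0 x g f)).le
        · simpa using h0 x g f
    _ = 1 := Fintype.expect_const _

lemma spread_numeric {m e : ℝ} (hm : 0 < m) (he : 0 < e) (hmn : m ^ 2 = n)
    (hF : 1 / (Fintype.card F : ℝ) ≤ m * e) {δ : ℝ} (hinc : inc S.ψ R S.toFamily ≤ δ)
    (hcons : 1 - e ^ 8 ≤ S.consProb) (hlin : 1 - e ^ 8 ≤ S.linProb) :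
    S.spread R ≤ 12 * e ^ 8 + 32 * m ^ 3 * e * δ + 10 * m * e ^ 3 := by
  have hdef : 𝔼 x, S.defect x ≤ 2 * e ^ 8 := by
    rw [expect_defect]
    linarith
  have hdef0 : 0 ≤ 𝔼 x, S.defect x := expect_nonneg fun x _ => S.defect_nonneg x
  have hfail := S.sum_expect_lineFail_le hlin
  -- The choice `c = e^4` balances `c` against `defect / c`, the defect being of order `e^8`. The
  -- choice of `s` is the smallest that the hypothesis on `1 / p` shows to be at least `4 / p`.
  have h1 := S.spread_reg2_le R (c := e ^ 4) (s := 4 * m * e) (by positivity) (by positivity)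
    (by linarith [show 4 / (Fintype.card F : ℝ) = 4 * (1 / Fintype.card F) by ring])
  have hinc0 : 0 ≤ inc S.ψ R S.toFamily := by
    rw [inc_toFamily]
    exact expect_nonneg fun z _ => expect_nonneg fun w _ => sum_nonneg fun g _ =>
      ev_nonneg S.ψ (reg1_mul_reg2_nonneg (R.op_nonneg z g)
        (S.sel_isStarProjection w z g).one_sub.nonneg)
  have hk : (k : ℝ) ≤ m ^ 2 := by
    rw [hmn]
    exact_mod_cast R.arity_le
  have h2 : k * (2 * (4 * m * e) * inc S.ψ R S.toFamily +
      2 / (4 * m * e) * (e ^ 4 + 1 / (2 * e ^ 4) * (3 * 𝔼 x, S.defect x))) ≤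
      m ^ 2 * (2 * (4 * m * e) * δ + 2 / (4 * m * e) * (e ^ 4 + 1 / (2 * e ^ 4) *
        (3 * (2 * e ^ 8)))) := by
    gcongr
  have h3 : 2 / (4 * m * e * e ^ 4) * ∑ i, 𝔼 x, 𝔼 t, 𝔼 t', 𝔼 t'', S.lineFail i x t t' t'' ≤
      2 / (4 * m * e * e ^ 4) * (m ^ 2 * e ^ 8) := by
    rw [hmn]
    gcongr
  have h4 : m ^ 2 * (2 * (4 * m * e) * δ + 2 / (4 * m * e) * (e ^ 4 + 1 / (2 * e ^ 4) *
        (3 * (2 * e ^ 8)))) = 8 * m ^ 3 * e * δ + 2 * m * e ^ 3 := by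
    field_simp
    ring
  have h5 : 2 / (4 * m * e * e ^ 4) * (m ^ 2 * e ^ 8) = 1 / 2 * m * e ^ 3 := by
    field_simp
    ring
  have h6 := S.spread_le R
  linarith

end Strategy

lemma spread_bound_le {m e δ : ℝ} (hm : 1 ≤ m) (he : 0 < e) (he0 : e ≤ 1 / 10000)
    (hme : m * e ≤ δ) (hδ : m ^ 16 * δ ≤ 1) :
    12 * e ^ 8 + 32 * m ^ 3 * e * δ + 10 * m * e ^ 3 ≤ δ := by
  have hδ0 : 0 < δ := lt_of_lt_of_le (by positivity) hme
  have h1 : m ^ 17 * e ≤ 1 := by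
    calc m ^ 17 * e = m ^ 16 * (m * e) := by ring
      _ ≤ m ^ 16 * δ := by gcongr
      _ ≤ 1 := hδ
  -- Compare squares: `(m³ e)² ≤ (m^17 e) e ≤ e ≤ 1/10000`.
  have h2 : m ^ 3 * e ≤ 1 / 100 := by
    by_contra h
    have h3 := pow_lt_pow_left₀ (not_le.1 h) (by norm_num) two_ne_zero
    have h4 : (m ^ 3 * e) ^ 2 ≤ m ^ 17 * e * e := by
      rw [mul_pow, ← pow_mul, mul_assoc, ← sq]
      gcongr
      norm_num
    nlinarith
  have heδ : e ≤ δ := by nlinarith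
  have he1 : e ≤ 1 := by linarith
  have h3 : 12 * e ^ 8 ≤ 1 / 10 * δ := by
    have : e ^ 7 ≤ e := pow_le_of_le_one he.le he1 (by norm_num)
    calc 12 * e ^ 8 = 12 * e ^ 7 * e := by ring
      _ ≤ 1 / 10 * δ := by
        gcongr
        linarith
  have h4 : 10 * m * e ^ 3 ≤ 1 / 10 * δ := by
    have : e ^ 2 ≤ e := pow_le_of_le_one he.le he1 (by norm_num)
    calc 10 * m * e ^ 3 = 10 * e ^ 2 * (m * e) := by ring
      _ ≤ 1 / 10 * δ := by
        gcongr
        linarith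
  have h5 : 32 * m ^ 3 * e * δ ≤ 32 / 100 * δ := by
    have := mul_le_mul_of_nonneg_right h2 hδ0.le
    linarith
  linarith

/-- A bound in terms of `e` alone, as the inconsistency of `T` must be bounded independently of `δ`.
-/
lemma spread_bound_le' {m e δ : ℝ} (hm : 1 ≤ m) (he : 0 < e) (hme : m * e ≤ δ)
    (hδ : m ^ 16 * δ ≤ 1) :
    12 * e ^ 8 + 32 * m ^ 3 * e * δ + 10 * m * e ^ 3 ≤ 54 * e := by
  have hδ0 : 0 < δ := lt_of_lt_of_le (by positivity) hme
  have hδ1 : δ ≤ 1 := by nlinarith [one_le_pow₀ (n := 16) hm]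
  have heδ : e ≤ δ := by nlinarith
  have he1 : e ≤ 1 := by linarith
  have h1 : e ^ 8 ≤ e := pow_le_of_le_one he.le he1 (by norm_num)
  have h2 : m ^ 3 * δ ≤ 1 := by
    refine le_trans ?_ hδ
    gcongr
    norm_num
  have h3 : 32 * m ^ 3 * e * δ ≤ 32 * e := by nlinarith
  have h4 : 10 * m * e ^ 3 ≤ 10 * e := by
    have h5 : e ^ 2 ≤ e := pow_le_of_le_one he.le he1 (by norm_num)
    have h6 : m * e ≤ 1 := by linarith
    have h7 : m * e * e ^ 2 ≤ 1 * e := mul_le_mul h6 h5 (by positivity) zero_le_one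
    linarith [show 10 * m * e ^ 3 = 10 * (m * e * e ^ 2) by ring]
  linarith

end MultilinGame

/-! ### Assembly of the proof. -/

theorem mainTheorem6 :
    ∃ C : ℝ, 0 < C ∧
      ∀ (F : Type*) [Field F] [Fintype F] [DecidableEq F]
        (d : Type*) [Fintype d] [DecidableEq d] (n k : ℕ) (hk : k ≤ n) (ε δ : ℝ)
        (S : MultilinGame.Strategy F d n) (R : MultilinGame.SubFamily F d n k),
        3 ≤ Fintype.card F → 0 < ε →
        δ ≤ (n : ℝ) ^ (-8 : ℝ) →
        √(n : ℝ) * ε ^ (1 / 8 : ℝ) ≤ δ →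
        1 / (Fintype.card F : ℝ) ≤ √(n : ℝ) * ε ^ (1 / 8 : ℝ) →
        1 - ε / 2 ≤ S.winProb →
        MultilinGame.inc S.ψ R S.toFamily ≤ δ →
        ∃ (T : MultilinGame.SubFamily F d n k)
          (Shat : (Fin n → F) → MultilinGame.ML F k → Matrix d d ℂ),
          MultilinGame.inc S.ψ T S.toFamily ≤ C * ε ^ (1 / 16 : ℝ) ∧
          (∀ (ℓ : ℕ) (P : MultilinGame.SubFamily F d n ℓ),
            |MultilinGame.cons S.ψ P R - MultilinGame.cons S.ψ P T| ≤ C * √δ) ∧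
          (∀ (x : Fin n → F) (a : F),
            ∑ g : MultilinGame.ML F k with g.1 (MultilinGame.headPart hk x) = a,
              Shat x g * (Shat x g)ᴴ ≤ S.A x a) ∧
          (∀ (z : MultilinGame.Tail F n k) (g : MultilinGame.ML F k),
            T.op z g = (𝔼 w : Fin k → F, Shat (MultilinGame.glue w z) g) *
              (𝔼 w : Fin k → F, Shat (MultilinGame.glue w z) g)ᴴ) ∧
          𝔼 x : Fin n → F, ∑ g : MultilinGame.ML F k,
            MultilinGame.rhoNormSq S.ψ
              (Shat x g - CFC.sqrt (T.op (MultilinGame.tailPart k x) g)) ≤ δ := by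
  -- `112 = 2 * 54 + 4`, from `inc_improve_le` with spread at most `54 e` and defect at most `2
  -- e^8`.
  refine ⟨112, by norm_num, ?_⟩
  intro F _ _ _ d _ _ n k hk ε δ S R hF hε hδ hεδ hFε hwin hinc
  obtain ⟨e, he, rfl⟩ : ∃ e : ℝ, 0 < e ∧ e ^ 8 = ε :=
    ⟨ε ^ (1 / 8 : ℝ), by positivity, by rw [← Real.rpow_natCast, ← Real.rpow_mul hε.le]; norm_num⟩
  have h8 : (e ^ 8) ^ (1 / 8 : ℝ) = e := by
    rw [← Real.rpow_natCast, ← Real.rpow_mul he.le]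
    norm_num
  have h16 : (e ^ 8) ^ (1 / 16 : ℝ) = √e := by
    rw [Real.sqrt_eq_rpow, ← Real.rpow_natCast, ← Real.rpow_mul he.le]
    norm_num
  rw [h8] at hεδ hFε
  rw [h16]
  set m := √(n : ℝ) with hm
  have hcard : (0 : ℝ) < Fintype.card F := by
    exact_mod_cast (by omega : 0 < Fintype.card F)
  -- The lower bound `1 / p` on `m * e` also rules out `n = 0`.
  have hm0 : 0 < m := pos_of_mul_pos_left (lt_of_lt_of_le (by positivity) hFε) he.le
  have hmn : m ^ 2 = n := Real.sq_sqrt (Nat.cast_nonneg n)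
  have hn : 1 ≤ n := by
    have : (0 : ℝ) < n := hmn ▸ by positivity
    exact_mod_cast this
  have hm1 : 1 ≤ m := Real.one_le_sqrt.2 (by exact_mod_cast hn)
  have hδm : m ^ 16 * δ ≤ 1 := by
    have h1 : (n : ℝ) ^ (-8 : ℝ) = (m ^ 16)⁻¹ := by
      rw [Real.rpow_neg (Nat.cast_nonneg n), ← hmn]
      norm_num [← pow_mul]
    rw [h1] at hδ
    calc m ^ 16 * δ ≤ m ^ 16 * (m ^ 16)⁻¹ := by gcongr
      _ = 1 := mul_inv_cancel₀ (by positivity)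
  have hδ0 : 0 < δ := lt_of_lt_of_le (by positivity) hεδ
  have hδ1 : δ ≤ 1 := by nlinarith [one_le_pow₀ (n := 16) hm1]
  have heδ : e ≤ δ := by nlinarith
  have hcons : 1 - e ^ 8 ≤ S.consProb := by
    have := S.linProb_le_one
    rw [MultilinGame.Strategy.winProb] at hwin
    linarith
  have hlin : 1 - e ^ 8 ≤ S.linProb := by
    have := S.consProb_le_one
    rw [MultilinGame.Strategy.winProb] at hwin
    linarith
  rcases le_or_gt e (1 / 10000) with hsmall | hlarge
  swap
  -- For large `e` the zero family suffices: `√δ ≥ 1/100`, while a consistency is at most `1` in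
  -- absolute value.
  · refine ⟨.zero F d hk, fun _ _ => 0, ?_, ?_, ?_, ?_, ?_⟩
    · rw [S.inc_zero]
      positivity
    · intro ℓ P
      rw [S.cons_zero, sub_zero]
      have h1 : 1 / 100 ≤ √δ := Real.le_sqrt_of_sq_le (by linarith)
      linarith [S.abs_cons_le_one R P]
    · intro x a
      simpa using S.A_nonneg x a
    · simp [MultilinGame.SubFamily.zero]
    · simpa [MultilinGame.SubFamily.zero, MultilinGame.rhoNormSq_eq_ev] using hδ0.le
  have hspread := S.spread_numeric R hm0 he hmn hFε hinc hcons hlin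
  have hdef : 𝔼 x, S.defect x ≤ 2 * e ^ 8 := by
    rw [S.expect_defect]
    linarith
  have he1 : e ≤ 1 := by linarith
  have he8 : e ^ 8 ≤ e := pow_le_of_le_one he.le he1 (by norm_num)
  obtain ⟨Y, hY, hYT⟩ := S.exists_root_factors R
  have hYg : ∀ (w : Fin k → F) (z : MultilinGame.Tail F n k) g,
      S.A (MultilinGame.glue w z) (g.1 (MultilinGame.headPart hk (MultilinGame.glue w z))) *
        Y (MultilinGame.tailPart k (MultilinGame.glue w z)) g = S.sel w z g * Y z g := by
    intro w z g
    rw [MultilinGame.headPart_glue, MultilinGame.tailPart_glue]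
    rfl
  have hmean : ∀ z g, 𝔼 w : Fin k → F, S.sel w z g * Y z g = CFC.sqrt ((S.improve R).op z g) := by
    intro z g
    rw [← Finset.expect_mul, ← hYT]
    rfl
  refine ⟨S.improve R, fun x g => S.A x (g.1 (MultilinGame.headPart hk x)) *
    Y (MultilinGame.tailPart k x) g, ?_, ?_, ?_, ?_, ?_⟩
  · have h1 := S.inc_improve_le R
    have h2 := MultilinGame.spread_bound_le' hm1 he hεδ hδm
    -- The argument gives the stronger order `ε^{1/8}`, weakened here to `ε^{1/16}`.
    have h3 : e ≤ √e := Real.le_sqrt_of_sq_le (by nlinarith)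
    linarith
  · intro ℓ P
    -- The parameter `c = √δ` balances `c` against `δ / c`.
    have h1 := S.abs_cons_sub_improve_le R (Real.sqrt_pos.2 hδ0) P
    have h2 : 1 / √δ * (2 * MultilinGame.inc S.ψ R S.toFamily + 2 * 𝔼 x, S.defect x) ≤
        1 / √δ * (6 * δ) := by
      gcongr
      linarith
    have h3 : 1 / √δ * (6 * δ) = 6 * √δ := by
      rw [div_mul_eq_mul_div, one_mul, mul_div_assoc, Real.div_sqrt]
    linarith [Real.sqrt_nonneg δ]
  · intro x a
    have h1 := S.sum_selected_conj_le (MultilinGame.tailPart k x) (MultilinGame.headPart hk x)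
      (fun g => Y (MultilinGame.tailPart k x) g * star (Y (MultilinGame.tailPart k x) g))
      (fun g => mul_star_self_nonneg _)
      ((Finset.sum_le_sum fun g _ => hY _ g).trans (R.sum_le_one _)) a
    rw [MultilinGame.glue_headPart_tailPart] at h1
    refine (le_of_eq (Finset.sum_congr rfl fun g _ => ?_)).trans h1
    simp only [MultilinGame.Strategy.sel, MultilinGame.glue_headPart_tailPart,
      ← Matrix.star_eq_conjTranspose, star_mul,
      (S.isStarProjection x _).isSelfAdjoint.star_eq, mul_assoc]
  · intro z g
    have h0 : 0 ≤ (S.improve R).op z g := (S.improve R).op_nonneg z g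
    simp only [hYg, hmean]
    rw [← Matrix.star_eq_conjTranspose,
      (IsSelfAdjoint.of_nonneg (CFC.sqrt_nonneg ((S.improve R).op z g))).star_eq,
      CFC.sqrt_mul_sqrt_self _ h0]
  · refine le_trans ?_ (hspread.trans
      (MultilinGame.spread_bound_le hm1 he hsmall hεδ hδm))
    rw [MultilinGame.expect_glue hk, MultilinGame.Strategy.spread]
    refine Finset.expect_le_expect fun z _ => Finset.expect_le_expect fun w _ =>
      Finset.sum_le_sum fun g _ => ?_
    have hs : star (S.sel w z g - S.selAvg z g) = S.sel w z g - S.selAvg z g := by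
      rw [star_sub, S.star_selAvg, (S.sel_isStarProjection w z g).isSelfAdjoint.star_eq]
    beta_reduce
    -- Both terms share the factor `Y`: the difference is `(p_w - B) Y`, and `Y Y† ≤ R` bounds its
    -- squared norm by the corresponding term of `spread`.
    rw [hYg, MultilinGame.tailPart_glue, ← hYT, ← sub_mul, MultilinGame.rhoNormSq_eq_ev,
      MultilinGame.wn, ← map_sub, ← map_star, ← map_mul, ← map_mul, hs, star_mul, hs]
    refine MultilinGame.ev_mono S.ψ ?_
    rw [← sub_nonneg, ← map_sub]
    refine MultilinGame.reg1_nonneg (sub_nonneg.2 ?_)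
    have h1 := IsSelfAdjoint.conjugate_le_conjugate (hY z g) hs
    simpa only [mul_assoc] using h1
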